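/- Let $E>0$ and $0<\nu<\tfrac12$. Then there are a point $C=(x_C,y_C)\in\mathbb R^2$ with $y_C<0$ and a constant friction coefficient $f>0$ with the following property. Let $\Omega$ be the open triangle with vertices $A=(-1,0)$, $B=(0,0)$ and $C$, made of a homogeneous isotropic linearly elastic material (plane strain) with Young's modulus $E$ and Poisson's ratio $\nu$, that is $\sigma(\mathbf u)=\Lambda\varepsilon(\mathbf u)=\frac{E}{1+\nu}\varepsilon(\mathbf u)+\frac{E\nu}{(1+\nu)(1-2\nu)}\operatorname{tr}(\varepsilon(\mathbf u))\,I$, $\varepsilon(\mathbf u)=\frac12(\nabla\mathbf u+{}^t\nabla\mathbf u)$. The body is clamped on $\Gamma_U=BC$, subject to no volume force, to a surface force $\mathbf T\in\mathbb R^2$, constant in space, on $\Gamma_T=AC$, and to unilateral contact (zero gap) with Coulomb friction, with coefficient $f$, on $\Gamma_C=AB$, whose outward unit normal is $\mathbf n=(0,1)$; write $v_{\rm n}=v_y$ and $\mathbf v_{\rm t}=(v_x,0)$ on $\Gamma_C$. Let $V=\{\mathbf u\in H^1(\Omega;\mathbb R^2):\mathbf u=0\text{ on }\Gamma_U\}$.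 (1) There are $\mathbf T\in\mathbb R^2$ and a tangential displacement $\mathbf w_{\rm t}\in H^{1/2}(\Gamma_C)$ for which the incremental problem has a continuum of solutions: there is a continuous injective map $\gamma:[0,1]\to V$ such that every $\mathbf u=\gamma(r)$ is affine on the triangle (the linear interpolation of its values at the vertices) and solves the incremental problem, namely the normal component $t_{\rm n}\in H^{-1/2}(\Gamma_C)$ of $\sigma(\mathbf u)\mathbf n$ on $\Gamma_C$ satisfies $t_{\rm n}\le0$, and $$\int_\Omega\varepsilon(\mathbf u):\Lambda\varepsilon(\mathbf v-\mathbf u)\ \ge\ \int_{\Gamma_T}\mathbf T\cdot(\mathbf v-\mathbf u)+\int_{\Gamma_C}t_{\rm n}(v_{\rm n}-u_{\rm n})+\int_{\Gamma_C}f\,t_{\rm n}\bigl[|\mathbf v_{\rm t}-\mathbf w_{\rm t}|-|\mathbf u_{\rm t}-\mathbf w_{\rm t}|\bigr]\quad\text{for all }\mathbf v\in V,$$ $$\int_{\Gamma_C}u_{\rm n}\,(t-t_{\rm n})\ \ge\ 0\quad\text{for all }t\in H^{-1/2}(\Gamma_C)\text{ with }t\le0.$$ (2) For every $S>0$ there are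 a Lipschitz-continuous load $\mathbf T:[0,S]\to\mathbb R^2$ and a right-continuous $\mathbf u:[0,S]\to V$ of bounded variation that solves the quasi-static problem, has an admissible initial value $\mathbf u(0)$, is affine on the triangle at each time, and jumps: $\mathbf u(s-)\ne\mathbf u(s+)$ for some $s\in[0,S]$. Here $\mathbf u_0\in V$ is admissible (for the load $\mathbf T(0)$) if there is $\tau\in H^{-1/2}(\Gamma_C)$, $\tau\le 0$, such that $\int_\Omega\varepsilon(\mathbf u_0):\Lambda\varepsilon(\mathbf v)\ge\int_{\Gamma_T}\mathbf T(0)\cdot\mathbf v+\int_{\Gamma_C}\tau v_{\rm n}+f\tau|\mathbf v_{\rm t}|$ for all $\mathbf v\in V$ and $\int_{\Gamma_C}u_{0,\rm n}(t-\tau)\ge0$ for all $t\le0$ in $H^{-1/2}(\Gamma_C)$. And $\mathbf u$ solves the quasi-static problem if there is a right-continuous $t_{\rm n}:[0,S]\to H^{-1/2}(\Gamma_C)$ of bounded variation with $t_{\rm n}(s)\le0$ for all $s$, such that, $\dot{\mathbf u}$ being the $V$-valued Stieltjes measure of $\mathbf u$, for every $V$-valued measure $\mathbf v$ of finite total variation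 on $[0,S]$, $$\int_{[0,S]}\!\int_\Omega\varepsilon(\mathbf u(s)):\Lambda\varepsilon(\mathbf v-\dot{\mathbf u})\ \ge\ \int_{[0,S]}\!\int_{\Gamma_T}\mathbf T(s)\cdot(\mathbf v-\dot{\mathbf u})+\int_{[0,S]}\!\int_{\Gamma_C}t_{\rm n}(s)\,(v_{\rm n}-\dot u_{\rm n})+\int_{[0,S]}\!\int_{\Gamma_C}f\,t_{\rm n}(s)\bigl[|\mathbf v_{\rm t}|-|\dot{\mathbf u}_{\rm t}|\bigr],$$ and $\int_{\Gamma_C}u_{\rm n}(s)\,(t-t_{\rm n}(s))\ge0$ for all $s$ and all $t\le0$ in $H^{-1/2}(\Gamma_C)$. Integrals against a vector measure $\mu$ are integrals of the density of $\mu$ with respect to its total variation measure $\|\mu\|$, against $\|\mu\|$. -/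

import Mathlib

open MeasureTheory Set Filter Topology
open scoped ENNReal NNReal

noncomputable section

namespace Friction

/-- The Euclidean plane. -/
abbrev Pt : Type := EuclideanSpace ℝ (Fin 2)

/-! ### General facts on `L²`, used to see that the spaces below are complete -/

theorem exists_subseq_ae {X F : Type*} [MeasurableSpace X] [NormedAddCommGroup F] {m : Measure X}
    {q : ℕ → Lp F 2 m} {q₀ : Lp F 2 m} (h : Tendsto q atTop (𝓝 q₀)) :
    ∃ n : ℕ → ℕ, StrictMono n ∧
      ∀ᵐ x ∂m, Tendsto (fun k => q (n k) x) atTop (𝓝 (q₀ x)) :=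
  (tendstoInMeasure_of_tendsto_Lp h).exists_seq_tendsto_ae

theorem continuous_integral_mul {X : Type*} [MeasurableSpace X] {m : Measure X} {φ : X → ℝ}
    (hφ : MemLp φ 2 m) : Continuous fun q : Lp ℝ 2 m => ∫ x, q x * φ x ∂m := by
  have h : (fun q : Lp ℝ 2 m => ∫ x, q x * φ x ∂m) = fun q => inner ℝ (hφ.toLp φ) q := by
    funext q
    rw [L2.inner_def]
    refine integral_congr_ae ?_
    filter_upwards [hφ.coeFn_toLp] with x hx
    simp [hx]
  rw [h]
  fun_prop

theorem continuous_integral_coord_mul {X : Type*} [MeasurableSpace X] {m : Measure X} {φ : X → ℝ}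
    (hφ : MemLp φ 2 m) (i : Fin 2) :
    Continuous fun q : Lp Pt 2 m => ∫ x, q x i * φ x ∂m := by
  have hf : MemLp (fun x => φ x • (EuclideanSpace.single i (1 : ℝ) : Pt)) 2 m := by
    refine hφ.mono (hφ.1.smul_const _) (ae_of_all _ fun x => ?_)
    simp [norm_smul]
  have h : (fun q : Lp Pt 2 m => ∫ x, q x i * φ x ∂m) = fun q => inner ℝ (hf.toLp _) q := by
    funext q
    rw [L2.inner_def]
    refine integral_congr_ae ?_
    filter_upwards [hf.coeFn_toLp] with x hx
    simp only [hx, real_inner_smul_left, EuclideanSpace.inner_single_left]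
    simp [mul_comm]
  rw [h]
  fun_prop

theorem integrable_coord_mul {X : Type*} [MeasurableSpace X] {m : Measure X} {φ : X → ℝ}
    (hφ : MemLp φ 2 m) (i : Fin 2) (q : Lp Pt 2 m) : Integrable (fun x => q x i * φ x) m :=
  MemLp.integrable_mul ((EuclideanSpace.proj (𝕜 := ℝ) i).comp_memLp q) hφ

theorem integrable_mul' {X : Type*} [MeasurableSpace X] {m : Measure X} {φ : X → ℝ}
    (hφ : MemLp φ 2 m) (q : Lp ℝ 2 m) : Integrable (fun x => q x * φ x) m :=
  MemLp.integrable_mul (Lp.memLp q) hφ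

/-! ### The space `H^{1/2}` of a curve -/

theorem ae_fst {m : Measure Pt} [IsFiniteMeasure m] {P : Pt → Prop} (h : ∀ᵐ x ∂m, P x) :
    ∀ᵐ z ∂(m.prod m), P z.1 :=
  Measure.quasiMeasurePreserving_fst.ae h

theorem ae_snd {m : Measure Pt} [IsFiniteMeasure m] {P : Pt → Prop} (h : ∀ᵐ x ∂m, P x) :
    ∀ᵐ z ∂(m.prod m), P z.2 :=
  Measure.quasiMeasurePreserving_snd.ae h

/-- Pairs of a function `h ∈ L²(m)` and its difference quotient `(h x - h y) / |x - y|`, the latter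
being required to be in `L²(m ⊗ m)`. -/
def HhalfSub (m : Measure Pt) [IsFiniteMeasure m] :
    Submodule ℝ (WithLp 2 (Lp ℝ 2 m × Lp ℝ 2 (m.prod m))) where
  carrier := {p | ∀ᵐ z ∂(m.prod m), p.snd z = (p.fst z.1 - p.fst z.2) / dist z.1 z.2}
  zero_mem' := by
    have h0 := Lp.coeFn_zero ℝ 2 m
    change ∀ᵐ z ∂(m.prod m), (0 : Lp ℝ 2 (m.prod m)) z =
      ((0 : Lp ℝ 2 m) z.1 - (0 : Lp ℝ 2 m) z.2) / dist z.1 z.2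
    filter_upwards [ae_fst h0, ae_snd h0, Lp.coeFn_zero ℝ 2 (m.prod m)] with z h1 h2 h3
    rw [h1, h2, h3]
    simp
  add_mem' := by
    intro p q hp hq
    have h0 := Lp.coeFn_add p.fst q.fst
    change ∀ᵐ z ∂(m.prod m), (p.snd + q.snd) z =
      ((p.fst + q.fst) z.1 - (p.fst + q.fst) z.2) / dist z.1 z.2
    filter_upwards [ae_fst h0, ae_snd h0, Lp.coeFn_add p.snd q.snd, hp, hq] with z h1 h2 h3 h4 h5
    rw [h1, h2, h3]
    simp only [Pi.add_apply, h4, h5]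
    ring
  smul_mem' := by
    intro c p hp
    have h0 := Lp.coeFn_smul c p.fst
    change ∀ᵐ z ∂(m.prod m), (c • p.snd) z =
      ((c • p.fst) z.1 - (c • p.fst) z.2) / dist z.1 z.2
    filter_upwards [ae_fst h0, ae_snd h0, Lp.coeFn_smul c p.snd, hp] with z h1 h2 h3 h4
    rw [h1, h2, h3]
    simp only [Pi.smul_apply, h4, smul_eq_mul]
    ring

theorem isClosed_HhalfSub (m : Measure Pt) [IsFiniteMeasure m] :
    IsClosed (HhalfSub m : Set (WithLp 2 (Lp ℝ 2 m × Lp ℝ 2 (m.prod m)))) := by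
  refine IsSeqClosed.isClosed fun p p₀ hp hlim => ?_
  have h1 : Tendsto (fun n => (p n).fst) atTop (𝓝 p₀.fst) :=
    ((WithLp.prod_continuous_ofLp 2 _ _).fst.tendsto p₀).comp hlim
  have h2 : Tendsto (fun n => (p n).snd) atTop (𝓝 p₀.snd) :=
    ((WithLp.prod_continuous_ofLp 2 _ _).snd.tendsto p₀).comp hlim
  obtain ⟨a, ha, ha'⟩ := exists_subseq_ae h1
  obtain ⟨b, hb, hb'⟩ := exists_subseq_ae (h2.comp ha.tendsto_atTop)
  have hall : ∀ᵐ z ∂(m.prod m), ∀ n,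
      (p n).snd z = ((p n).fst z.1 - (p n).fst z.2) / dist z.1 z.2 :=
    ae_all_iff.2 fun n => hp n
  filter_upwards [ae_fst ha', ae_snd ha', hb', hall] with z z1 z2 z3 z4
  have z1' := z1.comp hb.tendsto_atTop
  have z2' := z2.comp hb.tendsto_atTop
  refine tendsto_nhds_unique z3 (((z1'.sub z2').div_const (dist z.1 z.2)).congr fun k => ?_)
  simp [z4]

/-- The Hilbert space `H^{1/2}` of a curve with length measure `m`: the functions `h ∈ L²(m)` with
finite norm `(∫ |h x|² + ∫∫ |h x - h y|² / |x - y|²)^{1/2}`. -/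
def Hhalf (m : Measure Pt) [IsFiniteMeasure m] : Type := HhalfSub m

section HhalfOps

variable {m m' : Measure Pt} [IsFiniteMeasure m] [IsFiniteMeasure m']

instance : NormedAddCommGroup (Hhalf m) := inferInstanceAs (NormedAddCommGroup (HhalfSub m))
instance : InnerProductSpace ℝ (Hhalf m) := inferInstanceAs (InnerProductSpace ℝ (HhalfSub m))
instance : CompleteSpace (Hhalf m) := (isClosed_HhalfSub m).completeSpace_coe

/-- The function underlying an element of `H^{1/2}`. -/
def hfn (h : Hhalf m) : Lp ℝ 2 m := h.1.fst

theorem continuous_hfn : Continuous (hfn : Hhalf m → Lp ℝ 2 m) :=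
  (WithLp.prod_continuous_ofLp 2 _ _).fst.comp continuous_subtype_val

/-- The absolute value of an element of `H^{1/2}`. -/
def habs (h : Hhalf m) : Hhalf m :=
  have h1 : MemLp (fun x => |hfn h x|) 2 m := (Lp.memLp (hfn h)).abs
  have h2 : MemLp (fun z : Pt × Pt => (|hfn h z.1| - |hfn h z.2|) / dist z.1 z.2) 2
      (m.prod m) := by
    have hm : AEStronglyMeasurable (hfn h) m := (Lp.memLp (hfn h)).1
    refine (Lp.memLp h.1.snd).mono ?_ ?_
    · have e1 : AEMeasurable (fun z : Pt × Pt => |hfn h z.1|) (m.prod m) := by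
        simpa using (hm.comp_quasiMeasurePreserving
          Measure.quasiMeasurePreserving_fst).norm.aemeasurable
      have e2 : AEMeasurable (fun z : Pt × Pt => |hfn h z.2|) (m.prod m) := by
        simpa using (hm.comp_quasiMeasurePreserving
          Measure.quasiMeasurePreserving_snd).norm.aemeasurable
      exact ((e1.sub e2).div measurable_dist.aemeasurable).aestronglyMeasurable
    · filter_upwards [h.2] with z hz
      rw [hz, norm_div, norm_div]
      gcongr
      exact abs_abs_sub_abs_le _ _
  ⟨WithLp.toLp 2 (h1.toLp _, h2.toLp _), by
    change ∀ᵐ z ∂(m.prod m), h2.toLp _ z = (h1.toLp _ z.1 - h1.toLp _ z.2) / dist z.1 z.2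
    filter_upwards [h2.coeFn_toLp, ae_fst h1.coeFn_toLp, ae_snd h1.coeFn_toLp] with z a1 a2 a3
    rw [a1, a2, a3]⟩

/-- Restriction of an element of `H^{1/2}` to a part of the curve. -/
def hrestrict (hm : m' ≤ m) (h : Hhalf m) : Hhalf m' :=
  have h1 : MemLp (hfn h) 2 m' := (Lp.memLp (hfn h)).mono_measure hm
  have h2 : MemLp h.1.snd 2 (m'.prod m') :=
    (Lp.memLp h.1.snd).mono_measure (Measure.prod_mono hm hm)
  ⟨WithLp.toLp 2 (h1.toLp _, h2.toLp _), by
    change ∀ᵐ z ∂(m'.prod m'), h2.toLp _ z = (h1.toLp _ z.1 - h1.toLp _ z.2) / dist z.1 z.2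
    filter_upwards [h2.coeFn_toLp, ae_fst h1.coeFn_toLp, ae_snd h1.coeFn_toLp,
      (Measure.absolutelyContinuous_of_le (Measure.prod_mono hm hm)).ae_le h.2] with z a1 a2 a3 a4
    rw [a1, a2, a3]
    exact a4⟩

end HhalfOps

/-- The space `H^{-1/2}`, dual of `H^{1/2}`, with the dual norm. -/
abbrev HhalfDual (m : Measure Pt) [IsFiniteMeasure m] : Type := Hhalf m →L[ℝ] ℝ

/-- `t ≤ 0` for `t` in `H^{-1/2}`. -/
def NonposDual {m : Measure Pt} [IsFiniteMeasure m] (t : HhalfDual m) : Prop :=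
  ∀ h : Hhalf m, (∀ᵐ x ∂m, 0 ≤ hfn h x) → t h ≤ 0

/-! ### The triangle -/

/-- The vertex `A = (-1, 0)`. -/
def ptA : Pt := !₂[-1, 0]

/-- The vertex `B = (0, 0)`. -/
def ptB : Pt := !₂[0, 0]

/-- The open triangle with vertices `A`, `B` and `C`. -/
def tri (C : Pt) : Set Pt := interior (convexHull ℝ {ptA, ptB, C})

/-- The contact part `Γ_C` of the boundary: the edge `AB`. -/
def edgeC : Set Pt := segment ℝ ptA ptB

/-- The clamped part `Γ_U` of the boundary: the edge `BC`. -/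
def edgeU (C : Pt) : Set Pt := segment ℝ ptB C

/-- The loaded part `Γ_T` of the boundary: the edge `AC`. -/
def edgeT (C : Pt) : Set Pt := segment ℝ ptA C

/-- The boundary of the triangle. -/
def bdry (C : Pt) : Set Pt := edgeC ∪ edgeU C ∪ edgeT C

/-- Area measure on the triangle. -/
abbrev area (C : Pt) : Measure Pt := volume.restrict (tri C)

/-- Arc length (one-dimensional Hausdorff measure) on a curve. -/
abbrev len (Γ : Set Pt) : Measure Pt := (Measure.hausdorffMeasure 1).restrict Γ

theorem len_segment_lt_top (P Q : Pt) :
    (Measure.hausdorffMeasure 1 : Measure Pt) (segment ℝ P Q) < ∞ := by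
  rw [hausdorffMeasure_segment]
  exact edist_lt_top P Q

instance : IsFiniteMeasure (len edgeC) := ⟨by
  rw [Measure.restrict_apply_univ]; exact len_segment_lt_top _ _⟩

instance (C : Pt) : IsFiniteMeasure (len (edgeU C)) := ⟨by
  rw [Measure.restrict_apply_univ]; exact len_segment_lt_top _ _⟩

instance (C : Pt) : IsFiniteMeasure (len (edgeT C)) := ⟨by
  rw [Measure.restrict_apply_univ]; exact len_segment_lt_top _ _⟩

instance (C : Pt) : IsFiniteMeasure (len (bdry C)) := ⟨by
  rw [Measure.restrict_apply_univ, bdry]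
  exact measure_union_lt_top (measure_union_lt_top (len_segment_lt_top _ _)
    (len_segment_lt_top _ _)) (len_segment_lt_top _ _)⟩

theorem len_edgeC_le (C : Pt) : len edgeC ≤ len (bdry C) :=
  Measure.restrict_mono (fun _ hx => Or.inl (Or.inl hx)) le_rfl

theorem len_edgeU_le (C : Pt) : len (edgeU C) ≤ len (bdry C) :=
  Measure.restrict_mono (fun _ hx => Or.inl (Or.inr hx)) le_rfl

/-- The outward unit normal of a positively oriented polygon on its side from `P` to `Q`. -/
def sideNormal (P Q : Pt) : Pt := ‖Q - P‖⁻¹ • !₂[(Q - P) 1, -(Q - P) 0]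

open Classical in
/-- The outward unit normal of the triangle `ABC`, where `C` lies below the line `AB` (so that
`A`, `C`, `B` is the positive orientation), up to its values at the vertices. -/
def normal (C : Pt) (x : Pt) : Pt :=
  if x ∈ edgeC then sideNormal ptB ptA
  else if x ∈ edgeT C then sideNormal ptA C
  else sideNormal C ptB

theorem measurableSet_segment (P Q : Pt) : MeasurableSet (segment ℝ P Q) := by
  rw [segment_eq_image]
  exact (isCompact_Icc.image (by fun_prop)).isClosed.measurableSet

theorem measurable_normal (C : Pt) : Measurable (normal C) := by
  classical
  unfold normal
  exact Measurable.ite (measurableSet_segment _ _) measurable_const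
    (Measurable.ite (measurableSet_segment _ _) measurable_const measurable_const)

/-! ### Sobolev spaces -/

/-- Test functions: smooth functions on the plane with compact support (not necessarily
contained in the triangle). -/
def IsTest (ψ : Pt → ℝ) : Prop := ContDiff ℝ (⊤ : ℕ∞) ψ ∧ HasCompactSupport ψ

/-- The `i`-th partial derivative of a function on the plane. -/
def partialD (i : Fin 2) (ψ : Pt → ℝ) (x : Pt) : ℝ := fderiv ℝ ψ x (EuclideanSpace.single i 1)

/-- Triples of a function on `Ω`, a vector field on `Ω` and a function on `∂Ω`. -/
def Triple (C : Pt) : Type :=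
  WithLp 2 (Lp ℝ 2 (area C) × WithLp 2 (Lp Pt 2 (area C) × Hhalf (len (bdry C))))

instance (C : Pt) : NormedAddCommGroup (Triple C) := inferInstanceAs (NormedAddCommGroup
  (WithLp 2 (Lp ℝ 2 (area C) × WithLp 2 (Lp Pt 2 (area C) × Hhalf (len (bdry C))))))
instance (C : Pt) : InnerProductSpace ℝ (Triple C) := inferInstanceAs (InnerProductSpace ℝ
  (WithLp 2 (Lp ℝ 2 (area C) × WithLp 2 (Lp Pt 2 (area C) × Hhalf (len (bdry C))))))
instance (C : Pt) : CompleteSpace (Triple C) := inferInstanceAs (CompleteSpace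
  (WithLp 2 (Lp ℝ 2 (area C) × WithLp 2 (Lp Pt 2 (area C) × Hhalf (len (bdry C))))))

namespace Triple

variable {C : Pt}

/-- The function on `Ω`. -/
def fn (p : Triple C) : Lp ℝ 2 (area C) := WithLp.fst p

/-- The vector field on `Ω`. -/
def grad (p : Triple C) : Lp Pt 2 (area C) := WithLp.fst (WithLp.snd p)

/-- The function on `∂Ω`. -/
def tr (p : Triple C) : Hhalf (len (bdry C)) := WithLp.snd (WithLp.snd p)

theorem continuous_fn : Continuous (fn : Triple C → _) :=
  (WithLp.prod_continuous_ofLp 2 _ _).fst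

theorem continuous_grad : Continuous (grad : Triple C → _) :=
  (WithLp.prod_continuous_ofLp 2 _ _).fst.comp (WithLp.prod_continuous_ofLp 2 _ _).snd

theorem continuous_tr : Continuous (tr : Triple C → _) :=
  (WithLp.prod_continuous_ofLp 2 _ _).snd.comp (WithLp.prod_continuous_ofLp 2 _ _).snd

/-- Green's formula `∫_Ω (u ∂ᵢψ + Gᵢ ψ) = ∫_∂Ω h ψ nᵢ` against all test functions, for a triple
`(u, G, h)`. Test functions supported in `Ω` express that `G` is the weak gradient of `u`, the
others that `h` is the trace of `u` on `∂Ω`. -/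
def Green (p : Triple C) : Prop :=
  ∀ ψ : Pt → ℝ, IsTest ψ → ∀ i : Fin 2,
    (∫ x, p.fn x * partialD i ψ x ∂(area C)) + (∫ x, p.grad x i * ψ x ∂(area C)) =
      ∫ x, hfn p.tr x * (ψ x * normal C x i) ∂(len (bdry C))

end Triple

theorem memLp_test (m : Measure Pt) [IsFiniteMeasureOnCompacts m] {ψ : Pt → ℝ} (h : IsTest ψ) :
    MemLp ψ 2 m :=
  h.1.continuous.memLp_of_hasCompactSupport h.2

theorem memLp_partialD (m : Measure Pt) [IsFiniteMeasureOnCompacts m] {ψ : Pt → ℝ} (h : IsTest ψ)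
    (i : Fin 2) : MemLp (partialD i ψ) 2 m := by
  have hc : Continuous (partialD i ψ) :=
    (h.1.continuous_fderiv (by simp)).clm_apply continuous_const
  exact hc.memLp_of_hasCompactSupport (h.2.fderiv_apply (𝕜 := ℝ) _)

theorem memLp_test_normal (C : Pt) {ψ : Pt → ℝ} (h : IsTest ψ) (i : Fin 2) :
    MemLp (fun x => ψ x * normal C x i) 2 (len (bdry C)) := by
  have hn : ∃ K : ℝ, ∀ x, ‖normal C x i‖ ≤ K := by
    refine ⟨max ‖sideNormal ptB ptA i‖ (max ‖sideNormal ptA C i‖ ‖sideNormal C ptB i‖),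
      fun x => ?_⟩
    unfold normal
    split_ifs <;> simp
  obtain ⟨K, hK⟩ := hn
  have hm : AEStronglyMeasurable (fun x => normal C x i) (len (bdry C)) :=
    ((EuclideanSpace.proj (𝕜 := ℝ) i).continuous.measurable.comp
      (measurable_normal C)).aestronglyMeasurable
  refine ((memLp_test (len (bdry C)) h).const_mul K).mono
    (h.1.continuous.aestronglyMeasurable.mul hm) (ae_of_all _ fun x => ?_)
  rw [norm_mul, norm_mul, mul_comm]
  gcongr
  exact (hK x).trans (le_abs_self K)

theorem hfn_add_ae {m : Measure Pt} [IsFiniteMeasure m] (p q : Hhalf m) :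
    ∀ᵐ x ∂m, hfn (p + q) x = hfn p x + hfn q x := Lp.coeFn_add (hfn p) (hfn q)

theorem hfn_smul_ae {m : Measure Pt} [IsFiniteMeasure m] (c : ℝ) (p : Hhalf m) :
    ∀ᵐ x ∂m, hfn (c • p) x = c * hfn p x := Lp.coeFn_smul c (hfn p)

/-- The triples made of a function of `H¹(Ω)` whose trace vanishes on `Γ_U`, its weak gradient and
its trace. -/
def V₁Sub (C : Pt) : Submodule ℝ (Triple C) where
  carrier := {p | p.Green ∧ ∀ᵐ x ∂(len (edgeU C)), hfn p.tr x = 0}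
  zero_mem' := by
    refine ⟨fun ψ _ i => ?_, ?_⟩
    · have e1 : ∫ x, (0 : Triple C).fn x * partialD i ψ x ∂(area C) = 0 := by
        refine integral_eq_zero_of_ae ?_
        filter_upwards [Lp.coeFn_zero ℝ 2 (area C)] with x hx
        change (0 : Lp ℝ 2 (area C)) x * _ = 0
        rw [hx]
        simp
      have e2 : ∫ x, (0 : Triple C).grad x i * ψ x ∂(area C) = 0 := by
        refine integral_eq_zero_of_ae ?_
        filter_upwards [Lp.coeFn_zero Pt 2 (area C)] with x hx
        change (0 : Lp Pt 2 (area C)) x i * _ = 0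
        rw [hx]
        simp
      have e3 : ∫ x, hfn (0 : Triple C).tr x * (ψ x * normal C x i) ∂(len (bdry C)) = 0 := by
        refine integral_eq_zero_of_ae ?_
        filter_upwards [Lp.coeFn_zero ℝ 2 (len (bdry C))] with x hx
        change (0 : Lp ℝ 2 (len (bdry C))) x * _ = 0
        rw [hx]
        simp
      rw [e1, e2, e3, add_zero]
    · filter_upwards [(Measure.absolutelyContinuous_of_le (len_edgeU_le C)).ae_le
        (Lp.coeFn_zero ℝ 2 (len (bdry C)))] with x hx
      exact hx
  add_mem' := by
    rintro p q ⟨hp, hp'⟩ ⟨hq, hq'⟩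
    refine ⟨fun ψ hψ i => ?_, ?_⟩
    · have m1 := memLp_partialD (area C) hψ i
      have m2 := memLp_test (area C) hψ
      have m3 := memLp_test_normal C hψ i
      have e1 : ∫ x, (p + q).fn x * partialD i ψ x ∂(area C) =
          (∫ x, p.fn x * partialD i ψ x ∂(area C)) + ∫ x, q.fn x * partialD i ψ x ∂(area C) := by
        rw [← integral_add (integrable_mul' m1 _) (integrable_mul' m1 _)]
        refine integral_congr_ae ?_
        filter_upwards [Lp.coeFn_add p.fn q.fn] with x hx
        change (p.fn + q.fn : Lp ℝ 2 (area C)) x * _ = _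
        rw [hx, Pi.add_apply, add_mul]
      have e2 : ∫ x, (p + q).grad x i * ψ x ∂(area C) =
          (∫ x, p.grad x i * ψ x ∂(area C)) + ∫ x, q.grad x i * ψ x ∂(area C) := by
        rw [← integral_add (integrable_coord_mul m2 i _) (integrable_coord_mul m2 i _)]
        refine integral_congr_ae ?_
        filter_upwards [Lp.coeFn_add p.grad q.grad] with x hx
        change (p.grad + q.grad : Lp Pt 2 (area C)) x i * _ = _
        rw [hx, Pi.add_apply, PiLp.add_apply, add_mul]
      have e3 : ∫ x, hfn (p + q).tr x * (ψ x * normal C x i) ∂(len (bdry C)) =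
          (∫ x, hfn p.tr x * (ψ x * normal C x i) ∂(len (bdry C))) +
            ∫ x, hfn q.tr x * (ψ x * normal C x i) ∂(len (bdry C)) := by
        rw [← integral_add (integrable_mul' m3 _) (integrable_mul' m3 _)]
        refine integral_congr_ae ?_
        filter_upwards [hfn_add_ae p.tr q.tr] with x hx
        change hfn (p.tr + q.tr) x * _ = _
        rw [hx, add_mul]
      rw [e1, e2, e3, ← hp ψ hψ i, ← hq ψ hψ i]
      ring
    · filter_upwards [hp', hq', (Measure.absolutelyContinuous_of_le (len_edgeU_le C)).ae_le
        (hfn_add_ae p.tr q.tr)] with x h1 h2 h3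
      change hfn (p.tr + q.tr) x = 0
      rw [h3, h1, h2, add_zero]
  smul_mem' := by
    rintro c p ⟨hp, hp'⟩
    refine ⟨fun ψ hψ i => ?_, ?_⟩
    · have e1 : ∫ x, (c • p).fn x * partialD i ψ x ∂(area C) =
          c * ∫ x, p.fn x * partialD i ψ x ∂(area C) := by
        rw [← integral_const_mul]
        refine integral_congr_ae ?_
        filter_upwards [Lp.coeFn_smul c p.fn] with x hx
        change (c • p.fn : Lp ℝ 2 (area C)) x * _ = _
        rw [hx, Pi.smul_apply, smul_eq_mul, mul_assoc]
      have e2 : ∫ x, (c • p).grad x i * ψ x ∂(area C) =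
          c * ∫ x, p.grad x i * ψ x ∂(area C) := by
        rw [← integral_const_mul]
        refine integral_congr_ae ?_
        filter_upwards [Lp.coeFn_smul c p.grad] with x hx
        change (c • p.grad : Lp Pt 2 (area C)) x i * _ = _
        rw [hx, Pi.smul_apply, PiLp.smul_apply, smul_eq_mul, mul_assoc]
      have e3 : ∫ x, hfn (c • p).tr x * (ψ x * normal C x i) ∂(len (bdry C)) =
          c * ∫ x, hfn p.tr x * (ψ x * normal C x i) ∂(len (bdry C)) := by
        rw [← integral_const_mul]
        refine integral_congr_ae ?_
        filter_upwards [hfn_smul_ae c p.tr] with x hx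
        change hfn (c • p.tr) x * _ = _
        rw [hx, mul_assoc]
      rw [e1, e2, e3, ← hp ψ hψ i]
      ring
    · filter_upwards [hp', (Measure.absolutelyContinuous_of_le (len_edgeU_le C)).ae_le
        (hfn_smul_ae c p.tr)] with x h1 h3
      change hfn (c • p.tr) x = 0
      rw [h3, h1, mul_zero]

theorem isClosed_V₁Sub (C : Pt) : IsClosed (V₁Sub C : Set (Triple C)) := by
  have h1 : IsClosed {p : Triple C | p.Green} := by
    simp only [Triple.Green, Set.ofPred_forall]
    refine isClosed_iInter fun ψ => isClosed_iInter fun hψ => isClosed_iInter fun i => ?_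
    refine isClosed_eq ?_ ?_
    · exact ((continuous_integral_mul (memLp_partialD _ hψ i)).comp Triple.continuous_fn).add
        ((continuous_integral_coord_mul (memLp_test _ hψ) i).comp Triple.continuous_grad)
    · exact (continuous_integral_mul (memLp_test_normal C hψ i)).comp
        (continuous_hfn.comp Triple.continuous_tr)
  have h2 : IsClosed {p : Triple C | ∀ᵐ x ∂(len (edgeU C)), hfn p.tr x = 0} := by
    refine IsSeqClosed.isClosed fun p p₀ hp hlim => ?_
    have hl : Tendsto (fun n => hfn (p n).tr) atTop (𝓝 (hfn p₀.tr)) :=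
      ((continuous_hfn.comp Triple.continuous_tr).tendsto p₀).comp hlim
    obtain ⟨a, ha, ha'⟩ := exists_subseq_ae hl
    have hall : ∀ᵐ x ∂(len (edgeU C)), ∀ n, hfn (p n).tr x = 0 := ae_all_iff.2 fun n => hp n
    filter_upwards [hall, (Measure.absolutelyContinuous_of_le (len_edgeU_le C)).ae_le ha']
      with x x1 x2
    refine tendsto_nhds_unique x2 ?_
    simp [x1]
  exact h1.inter h2

/-- One component of `V`: the functions of `H¹(Ω)` with zero trace on `Γ_U`. An element is stored
with its weak gradient and with its trace in `H^{1/2}(∂Ω)`; by the trace theorem the norm inherited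
from the product is equivalent to the norm of `H¹(Ω)`. -/
def V₁ (C : Pt) : Type := V₁Sub C

instance (C : Pt) : NormedAddCommGroup (V₁ C) := inferInstanceAs (NormedAddCommGroup (V₁Sub C))
instance (C : Pt) : InnerProductSpace ℝ (V₁ C) := inferInstanceAs (InnerProductSpace ℝ (V₁Sub C))
instance (C : Pt) : CompleteSpace (V₁ C) := (isClosed_V₁Sub C).completeSpace_coe

/-- The space `V` of the displacements `u ∈ H¹(Ω; ℝ²)` with `u = 0` on `Γ_U`. -/
def V (C : Pt) : Type := PiLp 2 fun _ : Fin 2 => V₁ C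

instance (C : Pt) : NormedAddCommGroup (V C) :=
  inferInstanceAs (NormedAddCommGroup (PiLp 2 fun _ : Fin 2 => V₁ C))
instance (C : Pt) : InnerProductSpace ℝ (V C) :=
  inferInstanceAs (InnerProductSpace ℝ (PiLp 2 fun _ : Fin 2 => V₁ C))
instance (C : Pt) : CompleteSpace (V C) :=
  inferInstanceAs (CompleteSpace (PiLp 2 fun _ : Fin 2 => V₁ C))

namespace V

variable {C : Pt}

/-- The `i`-th component of a displacement, with its gradient and trace. -/
def comp (u : V C) (i : Fin 2) : Triple C := (WithLp.ofLp u i).1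

/-- The value `uᵢ(x)`. -/
def val (u : V C) (i : Fin 2) (x : Pt) : ℝ := (u.comp i).fn x

/-- The value `∂ⱼuᵢ(x)`. -/
def deriv (u : V C) (i j : Fin 2) (x : Pt) : ℝ := (u.comp i).grad x j

/-- The `i`-th component of the trace on `∂Ω`. -/
def trace (u : V C) (i : Fin 2) : Hhalf (len (bdry C)) := (u.comp i).tr

/-- The normal component on `Γ_C`, whose outward unit normal is `n = (0, 1)`. -/
def nor (u : V C) : Hhalf (len edgeC) := hrestrict (len_edgeC_le C) (u.trace 1)

/-- The tangential component on `Γ_C`, the tangential part being `u_t = (tang u, 0)`. -/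
def tang (u : V C) : Hhalf (len edgeC) := hrestrict (len_edgeC_le C) (u.trace 0)

/-- The linearized strain `ε(u)`. -/
def strain (u : V C) (x : Pt) : Matrix (Fin 2) (Fin 2) ℝ :=
  Matrix.of fun i j => (u.deriv i j x + u.deriv j i x) / 2

end V

/-! ### Elasticity -/

/-- Isotropic Hooke's law (plane strain) with Young's modulus `E` and Poisson's ratio `ν`:
`Λ e = 2 μ e + lam (tr e) I`, with the Lamé coefficients
`μ = E / (2 (1 + ν))` and `lam = E ν / ((1 + ν) (1 - 2 ν))`. -/
def hooke (E ν : ℝ) (e : Matrix (Fin 2) (Fin 2) ℝ) : Matrix (Fin 2) (Fin 2) ℝ :=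
  (2 * (E / (2 * (1 + ν)))) • e + (E * ν / ((1 + ν) * (1 - 2 * ν)) * e.trace) • 1

section Problems

variable {C : Pt}

/-- The bilinear form `a(u, v) = ∫_Ω ε(u) : Λ ε(v)`. -/
def elastic (E ν : ℝ) (u v : V C) : ℝ :=
  ∫ x, ∑ i, ∑ j, u.strain x i j * hooke E ν (v.strain x) i j ∂(area C)

/-- The work `∫_Ω F · v + ∫_{Γ_T} T · v` of a volume force `F` and a surface force `T`. -/
def load (F : Lp Pt 2 (area C)) (T : Lp Pt 2 (len (edgeT C))) (v : V C) : ℝ :=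
  (∫ x, ∑ i, F x i * v.val i x ∂(area C)) + ∫ x, ∑ i, T x i * hfn (v.trace i) x ∂(len (edgeT C))

/-- The pair `(tn, tt)` in `H^{-1/2}(Γ_C)` consists of the normal and tangential components of the
surface traction `σ(u) n` on `Γ_C`, for a displacement `u` in equilibrium with the forces `F` in
`Ω` and `T` on `Γ_T`: this is Stokes' formula
`⟨σ(u) n, v⟩ = ∫_Ω ε(u) : Λ ε(v) - ∫_Ω F · v - ∫_{Γ_T} T · v`. -/
def IsTraction (E ν : ℝ) (F : Lp Pt 2 (area C)) (T : Lp Pt 2 (len (edgeT C))) (u : V C)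
    (tn tt : HhalfDual (len edgeC)) : Prop :=
  ∀ v : V C, tn v.nor + tt v.tang = elastic E ν u v - load F T v

/-- `u` is a solution of the incremental problem with friction coefficient `f`, gap `g` and
tangential displacement `w` at the preceding time step. -/
def IsIncrementalSolution (E ν f : ℝ) (F : Lp Pt 2 (area C)) (T : Lp Pt 2 (len (edgeT C)))
    (g w : Hhalf (len edgeC)) (u : V C) : Prop :=
  ∃ tn tt : HhalfDual (len edgeC), IsTraction E ν F T u tn tt ∧
    (∀ v : V C, elastic E ν u (v - u) ≥ load F T (v - u) + tn (v.nor - u.nor) +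
      f * (tn (habs (v.tang - w)) - tn (habs (u.tang - w)))) ∧
    NonposDual tn ∧
    ∀ t : HhalfDual (len edgeC), NonposDual t → (t - tn) (u.nor - g) ≥ 0

/-- `u` is an admissible initial condition for the loads `F`, `T`: it belongs to the set
`𝒜(F, T, f)` of the equilibria compatible with the contact condition and the friction
threshold. -/
def IsAdmissible (E ν f : ℝ) (F : Lp Pt 2 (area C)) (T : Lp Pt 2 (len (edgeT C)))
    (g : Hhalf (len edgeC)) (u : V C) : Prop :=
  ∃ tn : HhalfDual (len edgeC), NonposDual tn ∧
    (∀ v : V C, elastic E ν u v ≥ load F T v + tn v.nor + f * tn (habs v.tang)) ∧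
    ∀ t : HhalfDual (len edgeC), NonposDual t → (t - tn) (u.nor - g) ≥ 0

end Problems

/-! ### Bounded variation in time -/

instance (S : ℝ) : CompactIccSpace (Icc (0 : ℝ) S) := ⟨fun {_ _} => isClosed_Icc.isCompact⟩

/-- Right-continuous functions of bounded variation on `[0, S]`. -/
def IsBVPlus {S : ℝ} {H : Type*} [NormedAddCommGroup H] (u : Icc (0 : ℝ) S → H) : Prop :=
  BoundedVariationOn u univ ∧ ∀ s, ContinuousWithinAt u (Ici s) s

/-- `d` is the Radon-Nikodym derivative of the vector measure `μ` with respect to its total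
variation measure. (If `H` is a Hilbert space and the total variation is finite, it exists and is
unique up to a negligible set.) -/
def IsPolar {X H : Type*} [MeasurableSpace X] [NormedAddCommGroup H] [NormedSpace ℝ H]
    (μ : VectorMeasure X H) (d : X → H) : Prop :=
  Integrable d μ.variation ∧ ∀ A, MeasurableSet A → μ A = ∫ x in A, d x ∂μ.variation

/-- `u` is a solution of the quasi-static problem on `[0, S]`, with friction coefficient `f`, gap
`g` and initial condition `u₀`. Here `du` is the derivative `u̇` of `u`, a `V`-valued measure on
`[0, S]`; the test measures `v` are the `V`-valued measures of finite total variation, and the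
integrals against vector measures are expressed with the Radon-Nikodym derivatives `ρ`, `ρv`, `ρu`
of `v - u̇`, `v` and `u̇` with respect to their total variations. -/
def IsQuasistaticSolution {C : Pt} (E ν f : ℝ) {S : ℝ} (hS : 0 ≤ S)
    (F : Icc (0 : ℝ) S → Lp Pt 2 (area C)) (T : Icc (0 : ℝ) S → Lp Pt 2 (len (edgeT C)))
    (g : Hhalf (len edgeC)) (u₀ : V C) (u : Icc (0 : ℝ) S → V C) : Prop :=
  IsBVPlus u ∧ u ⟨0, le_rfl, hS⟩ = u₀ ∧
  ∃ tn : Icc (0 : ℝ) S → HhalfDual (len edgeC), IsBVPlus tn ∧ (∀ s, NonposDual (tn s)) ∧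
    (∀ (hu : BoundedVariationOn u univ) (v : VectorMeasure (Icc (0 : ℝ) S) (V C)),
      IsFiniteMeasure v.variation →
      ∀ ρ ρv ρu : Icc (0 : ℝ) S → V C,
        IsPolar (v - hu.vectorMeasure) ρ → IsPolar v ρv → IsPolar hu.vectorMeasure ρu →
        ∫ s, elastic E ν (u s) (ρ s) ∂(v - hu.vectorMeasure).variation ≥
          (∫ s, load (F s) (T s) (ρ s) ∂(v - hu.vectorMeasure).variation) +
          (∫ s, tn s (ρ s).nor ∂(v - hu.vectorMeasure).variation) +
          ((∫ s, f * tn s (habs (ρv s).tang) ∂v.variation) -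
            ∫ s, f * tn s (habs (ρu s).tang) ∂hu.vectorMeasure.variation)) ∧
    ∀ s, ∀ t : HhalfDual (len edgeC), NonposDual t → (t - tn s) ((u s).nor - g) ≥ 0

/-! ### Linearly interpolated displacements -/

/-- The displacement `u` is linear on the triangle, with values `a` at `A` and `0` at `B` and
`C`. -/
def IsLinearInterp {C : Pt} (u : V C) (a : Pt) : Prop :=
  ∀ i, ∀ᵐ x ∂(area C), u.val i x = (-x 0 + C 0 / C 1 * x 1) * a i

/-- The surface force on `Γ_T` that is constant in space. -/
def constForce (C : Pt) (T : Pt) : Lp Pt 2 (len (edgeT C)) := Lp.const 2 (len (edgeT C)) T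

end Friction

end

noncomputable section

namespace Friction

/-! ### Integrals over segments -/

/-! The triangle and the friction coefficient are tuned so that one nonzero linear displacement is
an equilibrium under no load at all, with its contact traction exactly on the boundary of the
Coulomb cone. Let `slide` be affine with value (1, 0) at A and 0 at B and C. Its stress σ is
constant. With lam the first Lamé coefficient, f² = (1 - ν)/ν and C = (-2ν, -(1 - 2ν)/f), one finds
σ = -lam (f, -1) ⊗ (f, -1). This rank-one matrix kills the direction (1, f), which is normal to AC,
so AC is free of traction. On AB, where n = (0, 1), the traction is (lam f, -lam): compression, with
tangential part equal to f times the pressure. By Green's formula and the clamping on BC, the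
elastic work against v is therefore lam (f ∫ v_x - ∫ v_y), both integrals being over AB. This is
`exists_critical_triangle`, and everything after it uses only this identity.

The normal displacement of `slide` vanishes on AB, so contact is never lost and complementarity is
trivial. Every multiple r · `slide` with r ≥ 0 is an equilibrium with saturated friction, and the
friction pointing in the positive direction allows sliding in the negative direction. Since the
tangential displacement is nonnegative on AB, decreasing r is such a sliding. The friction
inequality reduces to v_x + |v_x| ≥ 0, with equality for the actual motion
(`integralDual_add_habs_nonneg`, `integralDual_habs_of_nonpos`). Starting from the tangential
displacement of `slide`, all r in [0, 1] thus solve the incremental problem. In time, r may even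
drop suddenly from 2 to 1 under zero load, which gives the jump.

The analytic work is the divergence theorem on the triangle (`integral_partialD`), which shows that
`slide` belongs to V. In the quasi-static problem, the derivative of the step function is a Dirac
measure (`vectorMeasure_stepDown_smul`), and `IsPolar.integral_stepDown_mul` removes the dependence
on the densities in the linear terms. -/

theorem setIntegral_segment (P Q : Pt) (hPQ : P ≠ Q) (g : Pt → ℝ) :
    ∫ x in segment ℝ P Q, g x ∂(Measure.hausdorffMeasure 1) =
      ‖Q - P‖ * ∫ t in (0 : ℝ)..1, g (P + t • (Q - P)) := by
  have hl : 0 < ‖Q - P‖ := norm_pos_iff.2 (sub_ne_zero.2 hPQ.symm)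
  set l := ‖Q - P‖ with hl'
  -- Parametrization by arc length: an isometry carries Lebesgue measure to Hausdorff measure on its
  -- range. Rescaling [0, l] to [0, 1] then produces the factor l.
  let φ : ℝ → Pt := fun t => P + t • (l⁻¹ • (Q - P))
  have hn : ‖l⁻¹ • (Q - P)‖ = 1 := by
    rw [norm_smul, norm_inv, norm_norm, ← hl']
    exact inv_mul_cancel₀ hl.ne'
  have hφ : Isometry φ := Isometry.of_dist_eq fun s t => by
    simp only [φ]
    rw [dist_add_left, dist_eq_norm, ← sub_smul, norm_smul, hn, mul_one, Real.dist_eq,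
      Real.norm_eq_abs]
  have hpre : φ ⁻¹' segment ℝ P Q = Icc 0 l := by
    have him : segment ℝ P Q = φ '' Icc 0 l := by
      rw [segment_eq_image']
      ext x
      constructor
      · rintro ⟨t, ⟨h0, h1⟩, rfl⟩
        refine ⟨t * l, ⟨by positivity, by nlinarith⟩, ?_⟩
        simp only [φ, smul_smul, mul_assoc, mul_inv_cancel₀ hl.ne', mul_one]
      · rintro ⟨t, ⟨h0, h1⟩, rfl⟩
        refine ⟨t / l, ⟨by positivity, (div_le_one hl).2 h1⟩, ?_⟩
        simp only [φ, smul_smul, div_eq_mul_inv]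
    rw [him, preimage_image_eq _ hφ.injective]
  have hrange : segment ℝ P Q ⊆ range φ := by
    rintro x ⟨a, b, ha, hb, hab, rfl⟩
    refine ⟨b * l, ?_⟩
    simp only [φ, smul_smul, mul_assoc, mul_inv_cancel₀ hl.ne', mul_one, smul_sub]
    rw [← eq_sub_iff_add_eq] at hab
    rw [hab, sub_smul, one_smul]
    abel
  have hmap : (Measure.hausdorffMeasure 1 : Measure Pt).restrict (segment ℝ P Q) =
      (Measure.map φ volume).restrict (segment ℝ P Q) := by
    rw [← Measure.restrict_restrict_of_subset hrange,
      ← hφ.map_hausdorffMeasure (Or.inl zero_le_one), hausdorffMeasure_real]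
  rw [hmap, hφ.isClosedEmbedding.measurableEmbedding.setIntegral_map, hpre,
    integral_Icc_eq_integral_Ioc, ← intervalIntegral.integral_of_le hl.le]
  have h := intervalIntegral.mul_integral_comp_mul_right (a := 0) (b := 1)
    (f := fun t => g (φ t)) l
  rw [zero_mul, one_mul] at h
  rw [← h]
  congr 2
  funext t
  simp only [φ, smul_smul, mul_assoc, mul_inv_cancel₀ hl.ne', mul_one]

/-- Points have zero length, so the side chosen at a vertex in the definition of `normal` is
irrelevant. -/
theorem ae_len_notMem_of_subset_singleton {Γ s : Set Pt} {P : Pt} (h : Γ ∩ s ⊆ {P})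
    (hΓ : MeasurableSet Γ) : ∀ᵐ x ∂(len Γ), x ∉ s := by
  have : NullSingletonClass (Measure.hausdorffMeasure 1 : Measure Pt) :=
    Measure.nullSingletonClass_hausdorff Pt one_pos
  have hP : (Measure.hausdorffMeasure 1 : Measure Pt) {P} = 0 := measure_singleton P
  rw [ae_restrict_iff' hΓ]
  filter_upwards [compl_mem_ae_iff.2 hP] with x hx hxΓ hxs
  exact hx (h ⟨hxΓ, hxs⟩)

/-! ### The sides of the triangle -/

section Sides

variable {C : Pt}

/-- The affine function with value `1` at `A` and `0` at `B` and `C`. -/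
def baryA (C : Pt) (x : Pt) : ℝ := -x 0 + C 0 / C 1 * x 1

theorem mem_edgeC_coord {x : Pt} (hx : x ∈ edgeC) : x 1 = 0 := by
  obtain ⟨a, b, -, -, -, rfl⟩ := hx
  simp [ptA, ptB]

theorem ptB_eq_zero : ptB = 0 := by
  ext i
  fin_cases i <;> simp [ptB]

theorem mem_edgeU_iff {x : Pt} : x ∈ edgeU C ↔ ∃ t ∈ Icc (0 : ℝ) 1, t • C = x := by
  rw [edgeU, segment_eq_image']
  simp [ptB_eq_zero]

theorem mem_edgeT_iff {x : Pt} :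
    x ∈ edgeT C ↔ ∃ t ∈ Icc (0 : ℝ) 1, ptA + t • (C - ptA) = x := by
  rw [edgeT, segment_eq_image']
  rfl

theorem edgeC_inter_edgeU (hC : C 1 < 0) : edgeC ∩ edgeU C ⊆ {0} := by
  rintro x ⟨h1, h2⟩
  obtain ⟨t, -, rfl⟩ := mem_edgeU_iff.1 h2
  have : t * C 1 = 0 := by simpa using mem_edgeC_coord h1
  rcases mul_eq_zero.1 this with h | h
  · simp [h]
  · exact absurd h hC.ne

theorem edgeC_inter_edgeT (hC : C 1 < 0) : edgeC ∩ edgeT C ⊆ {ptA} := by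
  rintro x ⟨h1, h2⟩
  obtain ⟨t, -, rfl⟩ := mem_edgeT_iff.1 h2
  have : t * C 1 = 0 := by simpa [ptA] using mem_edgeC_coord h1
  rcases mul_eq_zero.1 this with h | h
  · simp [h]
  · exact absurd h hC.ne

theorem baryA_of_mem_edgeU (hC : C 1 < 0) {x : Pt} (hx : x ∈ edgeU C) : baryA C x = 0 := by
  obtain ⟨t, -, rfl⟩ := mem_edgeU_iff.1 hx
  have := hC.ne
  simp [baryA]
  field_simp
  ring

theorem edgeU_inter_edgeT (hC : C 1 < 0) : edgeU C ∩ edgeT C ⊆ {C} := by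
  rintro x ⟨h1, h2⟩
  have h0 := baryA_of_mem_edgeU hC h1
  obtain ⟨t, -, rfl⟩ := mem_edgeT_iff.1 h2
  have := hC.ne
  have ht : t = 1 := by
    simp [baryA, ptA] at h0
    field_simp at h0
    linarith
  simp [ht]

theorem measurableSet_edgeC : MeasurableSet edgeC := measurableSet_segment _ _

theorem measurableSet_edgeU : MeasurableSet (edgeU C) := measurableSet_segment _ _

theorem measurableSet_edgeT : MeasurableSet (edgeT C) := measurableSet_segment _ _

theorem measurableSet_bdry : MeasurableSet (bdry C) :=
  (measurableSet_edgeC.union measurableSet_edgeU).union measurableSet_edgeT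

theorem len_edgeT_le (C : Pt) : len (edgeT C) ≤ len (bdry C) :=
  Measure.restrict_mono (fun _ hx => Or.inr hx) le_rfl

/-- An integral over the boundary is the sum of the integrals over the three sides. -/
theorem integral_bdry (hC : C 1 < 0) {g : Pt → ℝ} (hg : Integrable g (len (bdry C))) :
    ∫ x, g x ∂(len (bdry C)) =
      (∫ x, g x ∂(len edgeC)) + (∫ x, g x ∂(len (edgeU C))) + ∫ x, g x ∂(len (edgeT C)) := by
  have : NullSingletonClass (Measure.hausdorffMeasure 1 : Measure Pt) :=
    Measure.nullSingletonClass_hausdorff Pt one_pos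
  have h1 : AEDisjoint (Measure.hausdorffMeasure 1) edgeC (edgeU C) :=
    measure_mono_null (edgeC_inter_edgeU hC) (measure_singleton _)
  have h2 : AEDisjoint (Measure.hausdorffMeasure 1) (edgeC ∪ edgeU C) (edgeT C) := by
    refine measure_mono_null (t := {ptA} ∪ {C}) ?_ (measure_union_null (measure_singleton _)
      (measure_singleton _))
    rw [union_inter_distrib_right]
    exact union_subset_union (edgeC_inter_edgeT hC) (edgeU_inter_edgeT hC)
  have gC : IntegrableOn g edgeC (Measure.hausdorffMeasure 1) :=
    hg.mono_measure (len_edgeC_le C)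
  have gU : IntegrableOn g (edgeU C) (Measure.hausdorffMeasure 1) :=
    hg.mono_measure (len_edgeU_le C)
  have gT : IntegrableOn g (edgeT C) (Measure.hausdorffMeasure 1) :=
    hg.mono_measure (len_edgeT_le C)
  rw [bdry, setIntegral_union₀ h2 measurableSet_edgeT.nullMeasurableSet (gC.union gU) gT,
    setIntegral_union₀ h1 measurableSet_edgeU.nullMeasurableSet gC gU]

theorem normal_of_mem_edgeC {x : Pt} (hx : x ∈ edgeC) : normal C x = !₂[0, 1] := by
  rw [normal, if_pos hx, sideNormal]
  have h : ptA - ptB = !₂[-1, 0] := by ext i; fin_cases i <;> simp [ptA, ptB]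
  rw [h]
  ext i
  fin_cases i <;> simp [EuclideanSpace.norm_eq]

theorem normal_ae_edgeT (hC : C 1 < 0) :
    ∀ᵐ x ∂(len (edgeT C)), normal C x = sideNormal ptA C := by
  have h1 := ae_len_notMem_of_subset_singleton (Γ := edgeT C) (s := edgeC) (P := ptA)
    (by rw [inter_comm]; exact edgeC_inter_edgeT hC) measurableSet_edgeT
  filter_upwards [h1, ae_restrict_mem measurableSet_edgeT] with x hx hx'
  rw [normal, if_neg hx, if_pos hx']

theorem normal_ae_edgeU (hC : C 1 < 0) :
    ∀ᵐ x ∂(len (edgeU C)), normal C x = sideNormal C ptB := by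
  have h1 := ae_len_notMem_of_subset_singleton (Γ := edgeU C) (s := edgeC) (P := 0)
    (by rw [inter_comm]; exact edgeC_inter_edgeU hC) measurableSet_edgeU
  have h2 := ae_len_notMem_of_subset_singleton (Γ := edgeU C) (s := edgeT C) (P := C)
    (edgeU_inter_edgeT hC) measurableSet_edgeU
  filter_upwards [h1, h2] with x hx hx'
  rw [normal, if_neg hx, if_neg hx']

end Sides

/-! ### Integrals over the triangle -/

/-- The map `(s, t) ↦ s A + t C`, which maps the standard triangle onto the triangle `ABC`. -/
def param (C : Pt) (p : ℝ × ℝ) : Pt := p.1 • ptA + p.2 • C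

/-- The standard triangle in `ℝ²`. -/
def stdTri : Set (ℝ × ℝ) := {p | 0 ≤ p.1 ∧ 0 ≤ p.2 ∧ p.1 + p.2 ≤ 1}

theorem measurableSet_stdTri : MeasurableSet stdTri :=
  (measurableSet_le measurable_const measurable_fst).inter
    ((measurableSet_le measurable_const measurable_snd).inter
      (measurableSet_le (measurable_fst.add measurable_snd) measurable_const))

theorem isCompact_stdTri : IsCompact stdTri := by
  refine (isCompact_Icc (a := ((0, 0) : ℝ × ℝ)) (b := (1, 1))).of_isClosed_subset ?_ ?_
  · exact (isClosed_le continuous_const continuous_fst).inter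
      ((isClosed_le continuous_const continuous_snd).inter
        (isClosed_le (continuous_fst.add continuous_snd) continuous_const))
  · rintro ⟨s, t⟩ ⟨h1, h2, h3⟩
    simp only at h1 h2 h3
    exact ⟨⟨h1, h2⟩, ⟨by simp only; linarith, by simp only; linarith⟩⟩

section Area

variable {C : Pt}

theorem param_injective (hC : C 1 < 0) : Function.Injective (param C) := by
  rintro ⟨s, t⟩ ⟨s', t'⟩ h
  have h0 : s * (-1) + t * C 0 = s' * (-1) + t' * C 0 := by
    simpa [param, ptA] using congrArg (fun x : Pt => x 0) h
  have h1 : t * C 1 = t' * C 1 := by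
    simpa [param, ptA] using congrArg (fun x : Pt => x 1) h
  have ht : t = t' := mul_right_cancel₀ hC.ne h1
  subst ht
  ext <;> simp
  linarith

theorem continuous_param : Continuous (param C) := by
  unfold param
  fun_prop

theorem measurableEmbedding_param (hC : C 1 < 0) : MeasurableEmbedding (param C) :=
  continuous_param.measurableEmbedding (param_injective hC)

/-- In coordinates `param C` is the matrix with columns A and C, of determinant -C₁; pushing forward
divides area by its absolute value. -/
theorem map_param_volume (hC : C 1 < 0) :
    Measure.map (param C) volume = ENNReal.ofReal |(C 1)⁻¹| • (volume : Measure Pt) := by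
  let M : Matrix (Fin 2) (Fin 2) ℝ := !![-1, C 0; 0, C 1]
  let f : ℝ × ℝ →ₗ[ℝ] ℝ × ℝ :=
    Matrix.toLin (Module.Basis.finTwoProd ℝ) (Module.Basis.finTwoProd ℝ) M
  have hdet : LinearMap.det f = -C 1 := by
    simp only [f, LinearMap.det_toLin, M, Matrix.det_fin_two_of]
    ring
  let e : ℝ × ℝ → Pt := fun p => WithLp.toLp 2 (MeasurableEquiv.finTwoArrow.symm p)
  have he : MeasurePreserving e volume volume :=
    (PiLp.volume_preserving_toLp (Fin 2)).comp (volume_preserving_finTwoArrow ℝ).symm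
  have hpar : param C = e ∘ f := by
    funext p
    ext i
    fin_cases i <;>
      simp [param, e, f, M, ptA, Matrix.toLin_finTwoProd_apply, MeasurableEquiv.finTwoArrow,
        MeasurableEquiv.piFinTwo, mul_comm]
  have hf : Measurable f := f.continuous_of_finiteDimensional.measurable
  rw [hpar, ← Measure.map_map he.measurable hf, Measure.map_linearMap_addHaar_eq_smul_addHaar
    volume (by rw [hdet]; exact neg_ne_zero.2 hC.ne), Measure.map_smul, he.map_eq, hdet]
  congr 2
  rw [inv_neg, abs_neg]

theorem preimage_param_convexHull (hC : C 1 < 0) :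
    param C ⁻¹' convexHull ℝ {ptA, ptB, C} = stdTri := by
  have him : convexHull ℝ {ptA, ptB, C} = param C '' stdTri := by
    rw [convexHull_insert (by simp), convexHull_pair]
    ext x
    simp only [convexJoin, mem_singleton_iff, iUnion_iUnion_eq_left, mem_iUnion, exists_prop]
    constructor
    · rintro ⟨y, hy, a, b, ha, hb, hab, rfl⟩
      obtain ⟨t, ⟨h0, h1⟩, rfl⟩ := mem_edgeU_iff.1 hy
      refine ⟨(a, b * t), ⟨ha, by positivity, ?_⟩, ?_⟩
      · simp only
        nlinarith
      · simp [param, smul_smul]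
    · rintro ⟨⟨s, t⟩, ⟨h1, h2, h3⟩, rfl⟩
      simp only at h1 h2 h3
      -- The point s A + t C lies on the segment from A to the point t/(1 - s) C of BC. At s = 1 it
      -- is A itself, and any point of BC serves.
      rcases eq_or_lt_of_le (show s ≤ 1 by linarith) with rfl | hs
      · have ht : t = 0 := by linarith
        exact ⟨ptB, left_mem_segment _ _ _, 1, 0, by simp, by simp, by simp, by simp [param, ht]⟩
      · refine ⟨(t / (1 - s)) • C, mem_edgeU_iff.2 ⟨t / (1 - s), ⟨?_, ?_⟩, rfl⟩, s, 1 - s, h1,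
          by linarith, by ring, ?_⟩
        · exact div_nonneg h2 (by linarith)
        · rw [div_le_one (by linarith)]
          linarith
        · have : 1 - s ≠ 0 := by linarith
          simp only [param, smul_smul]
          rw [mul_div_cancel₀ _ this]
  rw [him, preimage_image_eq _ (param_injective hC)]

/-- Change of variables from the triangle `ABC` to the standard triangle. -/
theorem integral_area (hC : C 1 < 0) (g : Pt → ℝ) :
    ∫ x, g x ∂(area C) = -C 1 * ∫ p in stdTri, g (param C p) := by
  have hd : 0 < -C 1 := by linarith
  have hvol : (volume : Measure Pt) = ENNReal.ofReal (-C 1) • Measure.map (param C) volume := by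
    rw [map_param_volume hC, smul_smul, ← ENNReal.ofReal_mul hd.le, abs_inv, abs_of_neg hC,
      mul_inv_cancel₀ hd.ne', ENNReal.ofReal_one, one_smul]
  have hae : tri C =ᵐ[volume] convexHull ℝ {ptA, ptB, C} :=
    interior_ae_eq_of_null_frontier ((convex_convexHull ℝ _).addHaar_frontier volume)
  rw [area, Measure.restrict_congr_set hae, hvol, Measure.restrict_smul, integral_smul_measure,
    (measurableEmbedding_param hC).setIntegral_map, preimage_param_convexHull hC,
    ENNReal.toReal_ofReal hd.le, smul_eq_mul]

end Area

theorem integral_stdTri {h : ℝ × ℝ → ℝ} (hh : Continuous h) :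
    ∫ p in stdTri, h p = ∫ s in (0 : ℝ)..1, ∫ t in (0 : ℝ)..(1 - s), h (s, t) := by
  have hi : Integrable (stdTri.indicator h) (volume.prod volume) :=
    (integrable_indicator_iff measurableSet_stdTri).2 (hh.continuousOn.integrableOn_compact
      isCompact_stdTri)
  rw [← integral_indicator measurableSet_stdTri, Measure.volume_eq_prod, integral_prod _ hi,
    intervalIntegral.integral_of_le zero_le_one, ← integral_Icc_eq_integral_Ioc,
    ← integral_indicator measurableSet_Icc]
  congr 1
  funext s
  by_cases hs : s ∈ Icc (0 : ℝ) 1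
  · rw [indicator_of_mem hs, intervalIntegral.integral_of_le (by linarith [hs.2]),
      ← integral_Icc_eq_integral_Ioc, ← integral_indicator measurableSet_Icc]
    congr 1
    funext t
    have : (s, t) ∈ stdTri ↔ t ∈ Icc 0 (1 - s) :=
      ⟨fun h => ⟨h.2.1, by linarith [h.2.2]⟩, fun h => ⟨hs.1, h.1, by simp only; linarith [h.2]⟩⟩
    simp only [indicator, this]
  · rw [indicator_of_notMem hs]
    have : ∀ t, stdTri.indicator h (s, t) = 0 := fun t => by
      refine indicator_of_notMem (fun h => hs ⟨h.1, ?_⟩) _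
      have h2 := h.2.1
      have h3 := h.2.2
      simp only at h2 h3
      linarith
    simp [this]

/-- Lets Fubini be applied in the other order, so that derivatives along A can be integrated first.
-/
theorem integral_stdTri_swap {h : ℝ × ℝ → ℝ} :
    ∫ p in stdTri, h p.swap = ∫ p in stdTri, h p := by
  have hpre : (MeasurableEquiv.prodComm : ℝ × ℝ ≃ᵐ ℝ × ℝ) ⁻¹' stdTri = stdTri := by
    ext ⟨s, t⟩
    simp only [stdTri, mem_preimage, mem_ofPred_eq, MeasurableEquiv.prodComm, MeasurableEquiv.coe_mk,
      Equiv.prodComm_apply, Prod.swap_prod_mk]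
    constructor <;> rintro ⟨h1, h2, h3⟩ <;> exact ⟨h2, h1, by linarith⟩
  have hmp : MeasurePreserving (MeasurableEquiv.prodComm : ℝ × ℝ ≃ᵐ ℝ × ℝ) volume volume := by
    rw [Measure.volume_eq_prod]
    exact Measure.measurePreserving_swap
  have := hmp.setIntegral_preimage_emb MeasurableEquiv.prodComm.measurableEmbedding h stdTri
  rw [hpre] at this
  exact this

/-! ### The divergence theorem on the triangle -/

section Divergence

variable {C : Pt}

theorem hasDerivAt_comp_line {φ : Pt → ℝ} (hφ : ContDiff ℝ 1 φ) (P v : Pt) (t : ℝ) :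
    HasDerivAt (fun t : ℝ => φ (P + t • v)) (fderiv ℝ φ (P + t • v) v) t := by
  have h1 : HasFDerivAt φ (fderiv ℝ φ (P + t • v)) (P + t • v) :=
    (hφ.differentiable one_ne_zero _).hasFDerivAt
  have h2 : HasDerivAt (fun t : ℝ => P + t • v) v t := by
    simpa using ((hasDerivAt_id t).smul_const v).const_add P
  exact h1.comp_hasDerivAt t h2

theorem continuous_fderiv_apply' {φ : Pt → ℝ} (hφ : ContDiff ℝ 1 φ) (v : Pt) :
    Continuous fun x => fderiv ℝ φ x v :=
  (hφ.continuous_fderiv one_ne_zero).clm_apply continuous_const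

theorem integral_fderiv_line {φ : Pt → ℝ} (hφ : ContDiff ℝ 1 φ) (P v : Pt) (b : ℝ) :
    ∫ t in (0 : ℝ)..b, fderiv ℝ φ (P + t • v) v = φ (P + b • v) - φ P := by
  have hc : Continuous fun t : ℝ => fderiv ℝ φ (P + t • v) v :=
    (continuous_fderiv_apply' hφ v).comp (by fun_prop)
  rw [intervalIntegral.integral_eq_sub_of_hasDerivAt
    (fun t _ => hasDerivAt_comp_line hφ P v t) (hc.intervalIntegrable _ _)]
  simp

/-- Lines in the direction C enter the triangle through AB and leave it through AC; the fundamental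
theorem of calculus on each of them leaves the two boundary terms. -/
theorem integral_area_fderiv_C (hC : C 1 < 0) {φ : Pt → ℝ} (hφ : ContDiff ℝ 1 φ) :
    ∫ x, fderiv ℝ φ x C ∂(area C) =
      -C 1 * ((∫ t in (0 : ℝ)..1, φ (ptA + t • (C - ptA))) - ∫ t in (0 : ℝ)..1, φ (t • ptA)) := by
  have hc : Continuous fun p => fderiv ℝ φ (param C p) C :=
    (continuous_fderiv_apply' hφ C).comp continuous_param
  have hφc := hφ.continuous
  rw [integral_area hC, integral_stdTri hc]
  congr 1
  simp only [param, integral_fderiv_line hφ]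
  rw [intervalIntegral.integral_sub ((by fun_prop : Continuous _).intervalIntegrable _ _)
    ((by fun_prop : Continuous _).intervalIntegrable _ _)]
  congr 1
  have h := intervalIntegral.integral_comp_sub_left (a := 0) (b := 1)
    (fun t : ℝ => φ (ptA + t • (C - ptA))) 1
  rw [sub_self, sub_zero] at h
  rw [← h]
  congr 1
  funext t
  congr 1
  module

/-- The same along the direction A, whose lines run from BC to AC. -/
theorem integral_area_fderiv_A (hC : C 1 < 0) {φ : Pt → ℝ} (hφ : ContDiff ℝ 1 φ) :
    ∫ x, fderiv ℝ φ x ptA ∂(area C) =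
      -C 1 * ((∫ t in (0 : ℝ)..1, φ (ptA + t • (C - ptA))) - ∫ t in (0 : ℝ)..1, φ (t • C)) := by
  have hc : Continuous fun p : ℝ × ℝ => fderiv ℝ φ (param C p.swap) ptA :=
    (continuous_fderiv_apply' hφ ptA).comp (continuous_param.comp continuous_swap)
  have hφc := hφ.continuous
  rw [integral_area hC, ← integral_stdTri_swap, integral_stdTri hc]
  congr 1
  simp only [param, Prod.swap_prod_mk, add_comm _ (_ • C), integral_fderiv_line hφ]
  rw [intervalIntegral.integral_sub ((by fun_prop : Continuous _).intervalIntegrable _ _)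
    ((by fun_prop : Continuous _).intervalIntegrable _ _)]
  congr 2
  funext t
  congr 1
  module

theorem integrable_area {g : Pt → ℝ} (hg : Continuous g) : Integrable g (area C) := by
  have hK : IsCompact (convexHull ℝ {ptA, ptB, C}) :=
    Set.Finite.isCompact_convexHull (𝕜 := ℝ) (Set.toFinite {ptA, ptB, C})
  exact (hg.continuousOn.integrableOn_compact hK).mono_set interior_subset

theorem isCompact_bdry : IsCompact (bdry C) := by
  have h : ∀ P Q : Pt, IsCompact (segment ℝ P Q) := fun P Q => by
    rw [segment_eq_image]
    exact isCompact_Icc.image (by fun_prop)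
  exact ((h _ _).union (h _ _)).union (h _ _)

theorem integrable_mul_normal {g : Pt → ℝ} (hg : Continuous g) (i : Fin 2) :
    Integrable (fun x => g x * normal C x i) (len (bdry C)) := by
  have h1 : Integrable g (len (bdry C)) := by
    obtain ⟨K, hK⟩ := isCompact_bdry.exists_bound_of_continuousOn (f := g) hg.continuousOn
    refine Integrable.of_bound hg.aestronglyMeasurable K ?_
    filter_upwards [ae_restrict_mem measurableSet_bdry] with x hx using hK x hx
  refine h1.mul_bdd (c := max ‖sideNormal ptB ptA i‖
      (max ‖sideNormal ptA C i‖ ‖sideNormal C ptB i‖)) ?_ (ae_of_all _ fun x => ?_)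
  · exact ((EuclideanSpace.proj (𝕜 := ℝ) i).continuous.measurable.comp
      (measurable_normal C)).aestronglyMeasurable
  · unfold normal
    split_ifs <;> simp

theorem integral_side {P Q : Pt} (hPQ : P ≠ Q) (g : Pt → ℝ) (i : Fin 2) :
    ∫ x in segment ℝ P Q, g x * sideNormal P Q i ∂(Measure.hausdorffMeasure 1) =
      (![(Q - P) 1, -(Q - P) 0] : Fin 2 → ℝ) i * ∫ t in (0 : ℝ)..1, g (P + t • (Q - P)) := by
  have hl : ‖Q - P‖ ≠ 0 := norm_ne_zero_iff.2 (sub_ne_zero.2 hPQ.symm)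
  rw [integral_mul_const, setIntegral_segment P Q hPQ, sideNormal, PiLp.smul_apply, smul_eq_mul]
  field_simp

theorem sideNormal_swap (P Q : Pt) : sideNormal Q P = -sideNormal P Q := by
  rw [sideNormal, sideNormal, ← norm_neg, neg_sub, ← smul_neg]
  congr 1
  ext i
  fin_cases i <;> simp

/-- The divergence theorem on the triangle. -/
theorem integral_partialD (hC : C 1 < 0) {φ : Pt → ℝ} (hφ : ContDiff ℝ 1 φ) (i : Fin 2) :
    ∫ x, partialD i φ x ∂(area C) = ∫ x, φ x * normal C x i ∂(len (bdry C)) := by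
  have hAB : ptB ≠ ptA := fun h => by simpa [ptA, ptB] using congrArg (fun x : Pt => x 0) h
  have hAC : ptA ≠ C := fun h => hC.ne (by simp [← h, ptA])
  have hBC : ptB ≠ C := fun h => hC.ne (by simp [← h, ptB])
  have eC : ∫ x, φ x * normal C x i ∂(len edgeC) =
      (![0, 1] : Fin 2 → ℝ) i * ∫ t in (0 : ℝ)..1, φ (t • ptA) := by
    have h := integral_side hAB φ i
    rw [ptB_eq_zero] at h
    simp only [zero_add, sub_zero] at h
    have h2 : (![ptA 1, -ptA 0] : Fin 2 → ℝ) = ![0, 1] := by simp [ptA]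
    rw [h2] at h
    rw [← h, edgeC, segment_symm, ptB_eq_zero]
    refine setIntegral_congr_fun (measurableSet_segment _ _) fun x hx => ?_
    rw [segment_symm, ← ptB_eq_zero] at hx
    simp only
    rw [normal_of_mem_edgeC hx, sideNormal, sub_zero, h2]
    congr 1
    simp [ptA, EuclideanSpace.norm_eq]
  have eT : ∫ x, φ x * normal C x i ∂(len (edgeT C)) =
      (![(C - ptA) 1, -(C - ptA) 0] : Fin 2 → ℝ) i * ∫ t in (0 : ℝ)..1, φ (ptA + t • (C - ptA)) := by
    rw [← integral_side hAC]
    refine integral_congr_ae ?_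
    filter_upwards [normal_ae_edgeT hC] with x hx
    rw [hx]
  have eU : ∫ x, φ x * normal C x i ∂(len (edgeU C)) =
      -(![C 1, -C 0] : Fin 2 → ℝ) i * ∫ t in (0 : ℝ)..1, φ (t • C) := by
    have h := integral_side hBC φ i
    rw [ptB_eq_zero] at h
    simp only [zero_add, sub_zero] at h
    rw [neg_mul, ← h, ← integral_neg, edgeU, ptB_eq_zero]
    refine integral_congr_ae ?_
    have := normal_ae_edgeU hC
    rw [edgeU, ptB_eq_zero, sideNormal_swap] at this
    filter_upwards [this] with x hx
    rw [hx, PiLp.neg_apply, mul_neg]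
  rw [integral_bdry hC (integrable_mul_normal hφ.continuous i), eC, eT, eU]
  have hA := integral_area_fderiv_A hC hφ
  have hCc := integral_area_fderiv_C hC hφ
  have h0 : ∫ x, partialD 0 φ x ∂(area C) = -∫ x, fderiv ℝ φ x ptA ∂(area C) := by
    rw [← integral_neg]
    congr 1
    funext x
    have : (EuclideanSpace.single 0 1 : Pt) = -ptA := by
      ext i; fin_cases i <;> simp [ptA]
    rw [partialD, this, map_neg]
  -- The second basis vector is recovered from C₁ e₁ = C + C₀ A. The identity is kept multiplied by
  -- C₁, which is cancelled at the end.
  have h1 : C 1 * ∫ x, partialD 1 φ x ∂(area C) =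
      (∫ x, fderiv ℝ φ x C ∂(area C)) + C 0 * ∫ x, fderiv ℝ φ x ptA ∂(area C) := by
    rw [← integral_const_mul, ← integral_const_mul, ← integral_add
      (integrable_area (continuous_fderiv_apply' hφ C))
      ((integrable_area (continuous_fderiv_apply' hφ ptA)).const_mul _)]
    congr 1
    funext x
    have : C 1 • (EuclideanSpace.single 1 1 : Pt) = C + C 0 • ptA := by
      ext i; fin_cases i <;> simp [ptA]
    have h := congrArg (fderiv ℝ φ x) this
    simpa [partialD] using h
  have hA0 : ptA 0 = -1 := by simp [ptA]
  have hA1 : ptA 1 = 0 := by simp [ptA]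
  rw [hA] at h0 h1
  rw [hCc] at h1
  fin_cases i
  · simp only [Fin.zero_eta, Fin.isValue, h0]
    simp [hA0, hA1]
    ring
  · apply mul_left_cancel₀ hC.ne
    simp only [Fin.mk_one, Fin.isValue, h1]
    simp [hA0, hA1]
    ring

end Divergence

/-! ### Elements of `H^{1/2}` -/

section HhalfElements

variable {m m' : Measure Pt} [IsFiniteMeasure m] [IsFiniteMeasure m']

/-- The difference quotient stored with an element is determined by the function. -/
theorem Hhalf.ext_ae {h k : Hhalf m} (hk : ∀ᵐ x ∂m, hfn h x = hfn k x) : h = k := by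
  have h1 : h.1.fst = k.1.fst := Lp.ext hk
  have h2 : h.1.snd = k.1.snd := by
    refine Lp.ext ?_
    filter_upwards [h.2, k.2] with z hz kz
    rw [hz, kz, h1]
  refine Subtype.ext ?_
  exact (WithLp.ofLp_injective 2) (Prod.ext h1 h2)

theorem hfn_zero_ae : ∀ᵐ x ∂m, hfn (0 : Hhalf m) x = 0 := Lp.coeFn_zero ℝ 2 m

theorem hfn_sub_ae (p q : Hhalf m) : ∀ᵐ x ∂m, hfn (p - q) x = hfn p x - hfn q x :=
  Lp.coeFn_sub (hfn p) (hfn q)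

theorem hfn_habs_ae (h : Hhalf m) : ∀ᵐ x ∂m, hfn (habs h) x = |hfn h x| :=
  (Lp.memLp (hfn h)).abs.coeFn_toLp

theorem hfn_hrestrict_ae (hm : m' ≤ m) (h : Hhalf m) :
    ∀ᵐ x ∂m', hfn (hrestrict hm h) x = hfn h x :=
  ((Lp.memLp (hfn h)).mono_measure hm).coeFn_toLp

theorem integrable_hfn (h : Hhalf m) : Integrable (hfn h) m :=
  (Lp.memLp (hfn h)).integrable one_le_two

/-- A Lipschitz function, as an element of `H^{1/2}`. -/
def Hhalf.ofLipschitz (m : Measure Pt) [IsFiniteMeasure m] {g : Pt → ℝ} {K : ℝ≥0}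
    (hg : LipschitzWith K g) (hm : MemLp g 2 m) : Hhalf m :=
  have h2 : MemLp (fun z : Pt × Pt => (g z.1 - g z.2) / dist z.1 z.2) 2 (m.prod m) := by
    refine MemLp.of_bound ?_ K (ae_of_all _ fun z => ?_)
    · exact (((hg.continuous.measurable.comp measurable_fst).sub
        (hg.continuous.measurable.comp measurable_snd)).div
        measurable_dist).aestronglyMeasurable
    · rw [norm_div, Real.norm_of_nonneg dist_nonneg]
      exact div_le_of_le_mul₀ dist_nonneg K.2 (hg.dist_le_mul z.1 z.2)
  ⟨WithLp.toLp 2 (hm.toLp g, h2.toLp _), by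
    change ∀ᵐ z ∂(m.prod m), h2.toLp _ z = (hm.toLp g z.1 - hm.toLp g z.2) / dist z.1 z.2
    filter_upwards [h2.coeFn_toLp, ae_fst hm.coeFn_toLp, ae_snd hm.coeFn_toLp] with z a1 a2 a3
    rw [a1, a2, a3]⟩

theorem Hhalf.hfn_ofLipschitz_ae {g : Pt → ℝ} {K : ℝ≥0} (hg : LipschitzWith K g)
    (hm : MemLp g 2 m) : ∀ᵐ x ∂m, hfn (Hhalf.ofLipschitz m hg hm) x = g x :=
  hm.coeFn_toLp

/-- The functional `h ↦ ∫ h` on `H^{1/2}`. -/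
def integralDual (m : Measure Pt) [IsFiniteMeasure m] : HhalfDual m where
  toFun h := ∫ x, hfn h x ∂m
  map_add' p q := by
    rw [← integral_add (integrable_hfn p) (integrable_hfn q)]
    exact integral_congr_ae (hfn_add_ae p q)
  map_smul' c p := by
    rw [RingHom.id_apply, smul_eq_mul, ← integral_const_mul]
    exact integral_congr_ae (hfn_smul_ae c p)
  cont := by
    have h1 : MemLp (fun _ : Pt => (1 : ℝ)) 2 m := memLp_const 1
    have h := (continuous_integral_mul h1).comp continuous_hfn
    simp only [mul_one] at h
    exact h

theorem integralDual_apply (h : Hhalf m) : integralDual m h = ∫ x, hfn h x ∂m := rfl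

theorem integralDual_nonneg {h : Hhalf m} (hh : ∀ᵐ x ∂m, 0 ≤ hfn h x) :
    0 ≤ integralDual m h :=
  integral_nonneg_of_ae hh

theorem integralDual_habs (h : Hhalf m) : integralDual m (habs h) = ∫ x, |hfn h x| ∂m :=
  integral_congr_ae (hfn_habs_ae h)

/-- The integral of x + |x| ≥ 0. In the admissibility, incremental and quasi-static problems, the
variational inequality comes down to this once saturated friction has been inserted. -/
theorem integralDual_add_habs_nonneg (h : Hhalf m) :
    0 ≤ integralDual m h + integralDual m (habs h) := by
  rw [← map_add]
  refine integralDual_nonneg ?_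
  filter_upwards [hfn_add_ae h (habs h), hfn_habs_ae h] with x h1 h2
  rw [h1, h2]
  linarith [neg_abs_le (hfn h x)]

/-- The case of equality in the previous inequality: sliding in the negative direction, against the
friction force. -/
theorem integralDual_habs_of_nonpos {h : Hhalf m} (hh : ∀ᵐ x ∂m, hfn h x ≤ 0) :
    integralDual m (habs h) = -integralDual m h := by
  rw [integralDual_habs, integralDual_apply, ← integral_neg]
  refine integral_congr_ae ?_
  filter_upwards [hh] with x hx
  rw [abs_of_nonpos hx]

theorem nonposDual_neg_smul_integralDual {c : ℝ} (hc : 0 ≤ c) :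
    NonposDual (-c • integralDual m) := by
  intro h hh
  have := integralDual_nonneg hh
  simp only [smul_apply, smul_eq_mul, neg_mul]
  have := mul_nonneg hc this
  linarith

end HhalfElements

/-! ### Linear operations on displacements -/

section Linear

variable {C : Pt}

theorem V.trace_add (u v : V C) (i : Fin 2) : (u + v).trace i = u.trace i + v.trace i := rfl

theorem V.trace_smul (c : ℝ) (u : V C) (i : Fin 2) : (c • u).trace i = c • u.trace i := rfl

theorem V.tang_add (u v : V C) : (u + v).tang = u.tang + v.tang := by
  refine Hhalf.ext_ae ?_
  have h := (Measure.absolutelyContinuous_of_le (len_edgeC_le C)).ae_le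
    (hfn_add_ae (u.trace 0) (v.trace 0))
  filter_upwards [h, hfn_hrestrict_ae (len_edgeC_le C) ((u + v).trace 0),
    hfn_hrestrict_ae (len_edgeC_le C) (u.trace 0), hfn_hrestrict_ae (len_edgeC_le C) (v.trace 0),
    hfn_add_ae u.tang v.tang] with x h1 h2 h3 h4 h5
  rw [h5, V.tang, V.tang, V.tang, h2, h3, h4, V.trace_add, h1]

theorem V.tang_smul (c : ℝ) (u : V C) : (c • u).tang = c • u.tang := by
  refine Hhalf.ext_ae ?_
  have h := (Measure.absolutelyContinuous_of_le (len_edgeC_le C)).ae_le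
    (hfn_smul_ae c (u.trace 0))
  filter_upwards [h, hfn_hrestrict_ae (len_edgeC_le C) ((c • u).trace 0),
    hfn_hrestrict_ae (len_edgeC_le C) (u.trace 0),
    hfn_smul_ae c u.tang] with x h1 h2 h3 h5
  rw [h5, V.tang, V.tang, h2, h3, V.trace_smul, h1]

theorem V.nor_add (u v : V C) : (u + v).nor = u.nor + v.nor := by
  refine Hhalf.ext_ae ?_
  have h := (Measure.absolutelyContinuous_of_le (len_edgeC_le C)).ae_le
    (hfn_add_ae (u.trace 1) (v.trace 1))
  filter_upwards [h, hfn_hrestrict_ae (len_edgeC_le C) ((u + v).trace 1),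
    hfn_hrestrict_ae (len_edgeC_le C) (u.trace 1), hfn_hrestrict_ae (len_edgeC_le C) (v.trace 1),
    hfn_add_ae u.nor v.nor] with x h1 h2 h3 h4 h5
  rw [h5, V.nor, V.nor, V.nor, h2, h3, h4, V.trace_add, h1]

theorem V.nor_smul (c : ℝ) (u : V C) : (c • u).nor = c • u.nor := by
  refine Hhalf.ext_ae ?_
  have h := (Measure.absolutelyContinuous_of_le (len_edgeC_le C)).ae_le
    (hfn_smul_ae c (u.trace 1))
  filter_upwards [h, hfn_hrestrict_ae (len_edgeC_le C) ((c • u).trace 1),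
    hfn_hrestrict_ae (len_edgeC_le C) (u.trace 1),
    hfn_smul_ae c u.nor] with x h1 h2 h3 h5
  rw [h5, V.nor, V.nor, h2, h3, V.trace_smul, h1]

theorem V.tang_sub (u v : V C) : (u - v).tang = u.tang - v.tang :=
  eq_sub_of_add_eq (by rw [← V.tang_add, sub_add_cancel])

theorem V.nor_sub (u v : V C) : (u - v).nor = u.nor - v.nor :=
  eq_sub_of_add_eq (by rw [← V.nor_add, sub_add_cancel])

theorem V.val_smul_ae (c : ℝ) (u : V C) (i : Fin 2) :
    ∀ᵐ x ∂(area C), (c • u).val i x = c * u.val i x := Lp.coeFn_smul c (u.comp i).fn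

theorem V.deriv_smul_ae (c : ℝ) (u : V C) (i j : Fin 2) :
    ∀ᵐ x ∂(area C), (c • u).deriv i j x = c * u.deriv i j x := by
  filter_upwards [Lp.coeFn_smul c (u.comp i).grad] with x hx
  exact congrArg (fun y : Pt => y j) hx

theorem elastic_smul_left (E ν c : ℝ) (u v : V C) :
    elastic E ν (c • u) v = c * elastic E ν u v := by
  rw [elastic, elastic, ← integral_const_mul]
  refine integral_congr_ae ?_
  filter_upwards [V.deriv_smul_ae c u 0 0, V.deriv_smul_ae c u 0 1, V.deriv_smul_ae c u 1 0,
    V.deriv_smul_ae c u 1 1] with x h1 h2 h3 h4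
  simp only [V.strain, Fin.sum_univ_two, Matrix.of_apply, h1, h2, h3, h4]
  ring

theorem load_zero (v : V C) :
    load (0 : Lp Pt 2 (area C)) (constForce C 0) v = 0 := by
  have h1 : ∫ x, ∑ i, (0 : Lp Pt 2 (area C)) x i * v.val i x ∂(area C) = 0 := by
    refine integral_eq_zero_of_ae ?_
    filter_upwards [Lp.coeFn_zero Pt 2 (area C)] with x hx
    simp only [hx]
    simp
  have h2 : ∫ x, ∑ i, constForce C 0 x i * hfn (v.trace i) x ∂(len (edgeT C)) = 0 := by
    refine integral_eq_zero_of_ae ?_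
    filter_upwards [Lp.coeFn_const 2 (len (edgeT C)) (0 : Pt)] with x hx
    simp only [constForce, hx]
    simp
  rw [load, h1, h2, add_zero]

instance : IsFiniteMeasure (area C) := ⟨by
  have hK : IsCompact (convexHull ℝ {ptA, ptB, C}) :=
    Set.Finite.isCompact_convexHull (𝕜 := ℝ) (Set.toFinite {ptA, ptB, C})
  rw [Measure.restrict_apply_univ]
  exact (measure_mono interior_subset).trans_lt hK.measure_lt_top⟩

theorem V.integrable_deriv (v : V C) (i j : Fin 2) : Integrable (v.deriv i j) (area C) :=
  ((EuclideanSpace.proj (𝕜 := ℝ) j).comp_memLp (v.comp i).grad).integrable one_le_two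

/-- Green's formula against constants. -/
theorem V.integral_deriv (v : V C) (i j : Fin 2) :
    ∫ x, v.deriv i j x ∂(area C) = ∫ x, hfn (v.trace i) x * normal C x j ∂(len (bdry C)) := by
  have hK : IsCompact (convexHull ℝ {ptA, ptB, C} ∪ bdry C) :=
    (Set.Finite.isCompact_convexHull (𝕜 := ℝ) (Set.toFinite {ptA, ptB, C})).union isCompact_bdry
  obtain ⟨R, hR0, hR⟩ := hK.isBounded.subset_ball_lt 0 0
  -- A bump equal to 1 near the closed triangle stands in for the constant 1, which has no compact
  -- support.
  let b : ContDiffBump (0 : Pt) := ⟨R, R + 1, hR0, by linarith⟩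
  have hb : IsTest b := ⟨b.contDiff, b.hasCompactSupport⟩
  have h1 : ∀ x ∈ Metric.ball (0 : Pt) R, b x = 1 := fun x hx =>
    b.one_of_mem_closedBall (Metric.ball_subset_closedBall hx)
  have h2 : ∀ x ∈ Metric.ball (0 : Pt) R, partialD j b x = 0 := fun x hx => by
    have : (b : Pt → ℝ) =ᶠ[𝓝 x] fun _ => 1 := by
      filter_upwards [Metric.isOpen_ball.mem_nhds hx] with y hy using h1 y hy
    rw [partialD, this.fderiv_eq]
    simp
  have hG := (WithLp.ofLp v i).2.1 b hb j
  have hΩ : ∀ᵐ x ∂(area C), x ∈ Metric.ball (0 : Pt) R := by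
    filter_upwards [ae_restrict_mem isOpen_interior.measurableSet] with x hx
    exact hR (Or.inl (interior_subset hx))
  have hΓ : ∀ᵐ x ∂(len (bdry C)), x ∈ Metric.ball (0 : Pt) R := by
    filter_upwards [ae_restrict_mem measurableSet_bdry] with x hx
    exact hR (Or.inr hx)
  have e1 : ∫ x, (v.comp i).fn x * partialD j b x ∂(area C) = 0 := by
    refine integral_eq_zero_of_ae ?_
    filter_upwards [hΩ] with x hx
    simp [h2 x hx]
  have e2 : ∫ x, (v.comp i).grad x j * b x ∂(area C) = ∫ x, v.deriv i j x ∂(area C) := by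
    refine integral_congr_ae ?_
    filter_upwards [hΩ] with x hx
    simp [h1 x hx, V.deriv]
  have e3 : ∫ x, hfn (v.comp i).tr x * (b x * normal C x j) ∂(len (bdry C)) =
      ∫ x, hfn (v.trace i) x * normal C x j ∂(len (bdry C)) := by
    refine integral_congr_ae ?_
    filter_upwards [hΓ] with x hx
    simp [h1 x hx, V.trace]
  rw [← e2, ← e3, ← zero_add (∫ x, (v.comp i).grad x j * b x ∂(area C)), ← e1]
  exact hG

theorem V.integrable_trace_mul_normal (v : V C) (i j : Fin 2) :
    Integrable (fun x => hfn (v.trace i) x * normal C x j) (len (bdry C)) := by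
  refine (integrable_hfn (v.trace i)).mul_bdd (c := max ‖sideNormal ptB ptA j‖
      (max ‖sideNormal ptA C j‖ ‖sideNormal C ptB j‖)) ?_ (ae_of_all _ fun x => ?_)
  · exact ((EuclideanSpace.proj (𝕜 := ℝ) j).continuous.measurable.comp
      (measurable_normal C)).aestronglyMeasurable
  · unfold normal
    split_ifs <;> simp

/-- The integral of a partial derivative of a displacement, as a sum over the sides. -/
theorem V.integral_deriv_eq_sides (hC : C 1 < 0) (v : V C) (i j : Fin 2) :
    ∫ x, v.deriv i j x ∂(area C) =
      (∫ x, hfn (v.trace i) x ∂(len edgeC)) * (![0, 1] : Fin 2 → ℝ) j +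
      (∫ x, hfn (v.trace i) x ∂(len (edgeT C))) * sideNormal ptA C j := by
  rw [V.integral_deriv, integral_bdry hC (v.integrable_trace_mul_normal i j)]
  have eU : ∫ x, hfn (v.trace i) x * normal C x j ∂(len (edgeU C)) = 0 := by
    refine integral_eq_zero_of_ae ?_
    filter_upwards [(WithLp.ofLp v i).2.2] with x hx
    have : hfn (v.trace i) x = 0 := hx
    simp [this]
  rw [eU, add_zero, ← integral_mul_const, ← integral_mul_const]
  congr 1
  · refine setIntegral_congr_fun measurableSet_edgeC fun x hx => ?_
    simp only
    rw [normal_of_mem_edgeC hx]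
  · refine integral_congr_ae ?_
    filter_upwards [normal_ae_edgeT hC] with x hx
    rw [hx]

theorem integralDual_tang (v : V C) :
    integralDual (len edgeC) v.tang = ∫ x, hfn (v.trace 0) x ∂(len edgeC) :=
  integral_congr_ae (hfn_hrestrict_ae _ _)

theorem integralDual_nor (v : V C) :
    integralDual (len edgeC) v.nor = ∫ x, hfn (v.trace 1) x ∂(len edgeC) :=
  integral_congr_ae (hfn_hrestrict_ae _ _)

/-- The elastic work of a displacement with constant stress `σ`, the traction of which vanishes
on `AC`. -/
theorem elastic_of_const_strain (hC : C 1 < 0) {E ν : ℝ} {u : V C}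
    {e : Matrix (Fin 2) (Fin 2) ℝ} (he : ∀ᵐ x ∂(area C), u.strain x = e)
    (hs : e 1 0 = e 0 1)
    (hT : ∀ i, hooke E ν e i 0 * sideNormal ptA C 0 + hooke E ν e i 1 * sideNormal ptA C 1 = 0)
    (v : V C) :
    elastic E ν u v = hooke E ν e 0 1 * integralDual (len edgeC) v.tang +
      hooke E ν e 1 1 * integralDual (len edgeC) v.nor := by
  -- Hooke's law is self-adjoint and preserves symmetry, so ε(u) : Λ ε(v) = σ : ∇v with the constant
  -- stress σ = Λ e.
  have h1 : elastic E ν u v = ∫ x, (hooke E ν e 0 0 * v.deriv 0 0 x + hooke E ν e 0 1 *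
      v.deriv 0 1 x + (hooke E ν e 1 0 * v.deriv 1 0 x + hooke E ν e 1 1 * v.deriv 1 1 x))
      ∂(area C) := by
    refine integral_congr_ae ?_
    filter_upwards [he] with x hx
    simp only [hx]
    simp only [Fin.sum_univ_two, hooke, V.strain, Matrix.add_apply, Matrix.smul_apply,
      Matrix.of_apply, Matrix.trace_fin_two, smul_eq_mul, Matrix.one_apply_eq, ne_eq,
      zero_ne_one, one_ne_zero, not_false_eq_true, Matrix.one_apply_ne, hs]
    ring
  have hi : ∀ i, Integrable (fun x => hooke E ν e i 0 * v.deriv i 0 x +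
      hooke E ν e i 1 * v.deriv i 1 x) (area C) := fun i =>
    ((v.integrable_deriv i 0).const_mul _).add ((v.integrable_deriv i 1).const_mul _)
  have hs : ∀ i, ∫ x, (hooke E ν e i 0 * v.deriv i 0 x + hooke E ν e i 1 * v.deriv i 1 x)
      ∂(area C) = hooke E ν e i 0 * (∫ x, v.deriv i 0 x ∂(area C)) +
        hooke E ν e i 1 * ∫ x, v.deriv i 1 x ∂(area C) := fun i => by
    rw [← integral_const_mul, ← integral_const_mul]
    exact integral_add ((v.integrable_deriv i 0).const_mul _)
      ((v.integrable_deriv i 1).const_mul _)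
  refine h1.trans ((integral_add (hi 0) (hi 1)).trans ?_)
  rw [hs, hs]
  simp only [V.integral_deriv_eq_sides hC, integralDual_tang,
    integralDual_nor, Matrix.cons_val_zero, Matrix.cons_val_one]
  -- What remains on AC is the traction there, assumed to vanish, times the integral of v.
  linear_combination (∫ x, hfn (v.trace 0) x ∂(len (edgeT C))) * hT 0 +
    (∫ x, hfn (v.trace 1) x ∂(len (edgeT C))) * hT 1

end Linear

/-! ### The displacement with value `(1, 0)` at `A` -/

section Bary

variable {C : Pt}

theorem contDiff_baryA : ContDiff ℝ (⊤ : ℕ∞) (baryA C) := by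
  unfold baryA
  fun_prop

theorem lipschitz_baryA (C : Pt) : ∃ K : ℝ≥0, LipschitzWith K (baryA C) := by
  let l : Pt →L[ℝ] ℝ := -EuclideanSpace.proj 0 + (C 0 / C 1) • EuclideanSpace.proj 1
  refine ⟨‖l‖₊, ?_⟩
  have : baryA C = l := by
    funext x
    simp [baryA, l]
  rw [this]
  exact l.lipschitz

theorem partialD_baryA (i : Fin 2) (x : Pt) :
    partialD i (baryA C) x = (![-1, C 0 / C 1] : Fin 2 → ℝ) i := by
  let l : Pt →L[ℝ] ℝ := -EuclideanSpace.proj 0 + (C 0 / C 1) • EuclideanSpace.proj 1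
  have : baryA C = l := by
    funext x
    simp [baryA, l]
  rw [partialD, this, l.fderiv]
  fin_cases i <;> simp [l]

theorem memLp_baryA_area : MemLp (baryA C) 2 (area C) := by
  have hK : IsCompact (convexHull ℝ {ptA, ptB, C}) :=
    Set.Finite.isCompact_convexHull (𝕜 := ℝ) (Set.toFinite {ptA, ptB, C})
  have hc : Continuous (baryA C) := contDiff_baryA.continuous
  obtain ⟨K, hK⟩ := hK.exists_bound_of_continuousOn hc.continuousOn
  refine MemLp.of_bound hc.aestronglyMeasurable K ?_
  filter_upwards [ae_restrict_mem isOpen_interior.measurableSet] with x hx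
  exact hK x (interior_subset hx)

theorem memLp_baryA_bdry : MemLp (baryA C) 2 (len (bdry C)) := by
  have hc : Continuous (baryA C) := contDiff_baryA.continuous
  obtain ⟨K, hK⟩ := (isCompact_bdry (C := C)).exists_bound_of_continuousOn hc.continuousOn
  refine MemLp.of_bound hc.aestronglyMeasurable K ?_
  filter_upwards [ae_restrict_mem measurableSet_bdry] with x hx using hK x hx

/-- The function `baryA` with its gradient and its trace. -/
def baryTriple (C : Pt) : Triple C :=
  WithLp.toLp 2 (memLp_baryA_area.toLp (baryA C),
    WithLp.toLp 2 (Lp.const 2 (area C) (!₂[-1, C 0 / C 1] : Pt),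
      Hhalf.ofLipschitz (len (bdry C)) (lipschitz_baryA C).choose_spec memLp_baryA_bdry))

theorem baryTriple_fn_ae : ∀ᵐ x ∂(area C), (baryTriple C).fn x = baryA C x :=
  memLp_baryA_area.coeFn_toLp

theorem baryTriple_grad_ae :
    ∀ᵐ x ∂(area C), (baryTriple C).grad x = (!₂[-1, C 0 / C 1] : Pt) :=
  Lp.coeFn_const 2 (area C) (!₂[-1, C 0 / C 1] : Pt)

theorem baryTriple_tr_ae : ∀ᵐ x ∂(len (bdry C)), hfn (baryTriple C).tr x = baryA C x :=
  Hhalf.hfn_ofLipschitz_ae (lipschitz_baryA C).choose_spec memLp_baryA_bdry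

/-- Green's formula against ψ is the divergence theorem for the product `baryA C` · ψ. -/
theorem baryTriple_mem (hC : C 1 < 0) : baryTriple C ∈ V₁Sub C := by
  refine ⟨fun ψ hψ i => ?_, ?_⟩
  · have hψ1 : ContDiff ℝ 1 ψ := hψ.1.of_le (by exact_mod_cast le_top)
    have hb1 : ContDiff ℝ 1 (baryA C) := contDiff_baryA.of_le (by exact_mod_cast le_top)
    have hφ : ContDiff ℝ 1 fun x => baryA C x * ψ x := hb1.mul hψ1
    have e1 : ∫ x, (baryTriple C).fn x * partialD i ψ x ∂(area C) =
        ∫ x, baryA C x * partialD i ψ x ∂(area C) := by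
      refine integral_congr_ae ?_
      filter_upwards [baryTriple_fn_ae] with x hx
      rw [hx]
    have e2 : ∫ x, (baryTriple C).grad x i * ψ x ∂(area C) =
        ∫ x, partialD i (baryA C) x * ψ x ∂(area C) := by
      refine integral_congr_ae ?_
      filter_upwards [baryTriple_grad_ae] with x hx
      rw [hx, partialD_baryA]
    have e3 : ∫ x, hfn (baryTriple C).tr x * (ψ x * normal C x i) ∂(len (bdry C)) =
        ∫ x, baryA C x * ψ x * normal C x i ∂(len (bdry C)) := by
      refine integral_congr_ae ?_
      filter_upwards [baryTriple_tr_ae] with x hx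
      rw [hx, mul_assoc]
    have c1 : Continuous fun x => baryA C x * partialD i ψ x :=
      hb1.continuous.mul (continuous_fderiv_apply' hψ1 _)
    have c2 : Continuous fun x => partialD i (baryA C) x * ψ x :=
      (continuous_fderiv_apply' hb1 _).mul hψ1.continuous
    rw [e1, e2, e3, ← integral_partialD hC hφ i, ← integral_add (integrable_area c1)
      (integrable_area c2)]
    congr 1
    funext x
    have := fderiv_fun_mul (hb1.differentiable one_ne_zero x) (hψ1.differentiable one_ne_zero x)
    simp only [partialD, this]
    simp [mul_comm]
  · filter_upwards [(Measure.absolutelyContinuous_of_le (len_edgeU_le C)).ae_le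
      (baryTriple_tr_ae (C := C)), ae_restrict_mem measurableSet_edgeU] with x h1 h2
    rw [h1, baryA_of_mem_edgeU hC h2]

/-- The displacement that is linear on the triangle, with value `(1, 0)` at `A` and `0` at `B` and
`C`. -/
def slide (hC : C 1 < 0) : V C := WithLp.toLp 2 ![⟨baryTriple C, baryTriple_mem hC⟩, 0]

variable (hC : C 1 < 0)

theorem slide_val_zero_ae : ∀ᵐ x ∂(area C), (slide hC).val 0 x = baryA C x := baryTriple_fn_ae

theorem slide_val_one_ae : ∀ᵐ x ∂(area C), (slide hC).val 1 x = 0 := Lp.coeFn_zero ℝ 2 (area C)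

theorem slide_strain_ae : ∀ᵐ x ∂(area C),
    (slide hC).strain x = !![-1, C 0 / C 1 / 2; C 0 / C 1 / 2, 0] := by
  filter_upwards [baryTriple_grad_ae (C := C), Lp.coeFn_zero Pt 2 (area C)] with x h1 h2
  have h1' : ∀ j, (slide hC).deriv 0 j x = (!₂[-1, C 0 / C 1] : Pt) j := fun j =>
    congrArg (fun y : Pt => y j) h1
  have h2' : ∀ j, (slide hC).deriv 1 j x = (0 : Pt) j := fun j =>
    congrArg (fun y : Pt => y j) h2
  ext i j
  fin_cases i <;> fin_cases j <;> simp [V.strain, h1', h2']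

theorem slide_nor : (slide hC).nor = 0 := by
  refine Hhalf.ext_ae ?_
  filter_upwards [hfn_hrestrict_ae (len_edgeC_le C) ((slide hC).trace 1),
    (Measure.absolutelyContinuous_of_le (len_edgeC_le C)).ae_le
      (hfn_zero_ae (m := len (bdry C))), hfn_zero_ae (m := len edgeC)] with x h1 h2 h3
  rw [h3]
  exact h1.trans h2

theorem slide_tang_ae : ∀ᵐ x ∂(len edgeC), hfn (slide hC).tang x = -x 0 := by
  filter_upwards [hfn_hrestrict_ae (len_edgeC_le C) ((slide hC).trace 0),
    (Measure.absolutelyContinuous_of_le (len_edgeC_le C)).ae_le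
      (baryTriple_tr_ae (C := C)), ae_restrict_mem measurableSet_edgeC] with x h1 h2 h3
  have h4 : hfn (slide hC).tang x = baryA C x := h1.trans h2
  rw [h4, baryA, mem_edgeC_coord h3]
  ring

theorem slide_tang_nonneg : ∀ᵐ x ∂(len edgeC), 0 ≤ hfn (slide hC).tang x := by
  filter_upwards [slide_tang_ae hC, ae_restrict_mem measurableSet_edgeC] with x h1 h2
  obtain ⟨a, b, ha, -, -, rfl⟩ := h2
  rw [h1]
  simpa [ptA, ptB] using ha

/-- Serves to show that `slide` is nonzero, hence that the solutions are distinct and that the jump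
is real. -/
theorem integralDual_slide_tang_pos : 0 < integralDual (len edgeC) (slide hC).tang := by
  have h1 : integralDual (len edgeC) (slide hC).tang = ∫ x, -x 0 ∂(len edgeC) :=
    integral_congr_ae (slide_tang_ae hC)
  have hAB : ptA ≠ ptB := fun h => by simpa [ptA, ptB] using congrArg (fun x : Pt => x 0) h
  have hl : 0 < ‖ptB - ptA‖ := norm_pos_iff.2 (sub_ne_zero.2 hAB.symm)
  rw [h1, edgeC, setIntegral_segment _ _ hAB]
  refine mul_pos hl ?_
  have : ∀ t : ℝ, -(ptA + t • (ptB - ptA)) 0 = 1 - t := fun t => by simp [ptA, ptB]; ring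
  simp only [this]
  rw [intervalIntegral.integral_sub (by simp) (by simp)]
  norm_num

theorem isLinearInterp_smul_slide (r : ℝ) : IsLinearInterp (r • slide hC) !₂[r, 0] := by
  intro i
  filter_upwards [V.val_smul_ae r (slide hC) 0, V.val_smul_ae r (slide hC) 1,
    slide_val_zero_ae hC, slide_val_one_ae hC] with x h1 h2 h3 h4
  fin_cases i
  · simp only [Fin.zero_eta, Fin.isValue, h1, h3, baryA]
    simp [mul_comm]
  · simp [h2, h4]

theorem slide_ne_zero : slide hC ≠ 0 := by
  intro h
  have h1 := integralDual_slide_tang_pos hC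
  have h2 : (0 : V C).tang = 0 := by
    have := V.tang_smul (0 : ℝ) (0 : V C)
    rwa [zero_smul, zero_smul] at this
  rw [h, h2, map_zero] at h1
  exact lt_irrefl _ h1

end Bary

/-! ### The geometry -/

/-- A triangle and a friction coefficient for which `slide` is an equilibrium without load, under
a traction on `Γ_C` that lies on the boundary of the friction cone. -/
theorem exists_critical_triangle {E ν : ℝ} (hE : 0 < E) (hν : 0 < ν) (hν' : ν < 1 / 2) :
    ∃ (C : Pt) (hC : C 1 < 0) (f lam : ℝ), 0 < f ∧ 0 < lam ∧ ∀ v : V C,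
      elastic E ν (slide hC) v = lam * (f * integralDual (len edgeC) v.tang -
        integralDual (len edgeC) v.nor) := by
  have hν1 : 0 < 1 - ν := by linarith
  have hν2 : 0 < 1 - 2 * ν := by linarith
  have hν3 : 0 < 1 + ν := by linarith
  -- The value of f² is the ratio σ₀₀/σ₁₁ for `slide`. It makes σ singular once σ₀₁ = -f σ₁₁.
  obtain ⟨f, hf, hff⟩ : ∃ f : ℝ, 0 < f ∧ f ^ 2 = (1 - ν) / ν :=
    ⟨√((1 - ν) / ν), by positivity, Real.sq_sqrt (by positivity)⟩
  have hff' : f * f * ν = 1 - ν := by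
    rw [← sq, hff]
    field_simp
  -- Two conditions determine C: saturated friction σ₀₁ = lam f forces C₀/C₁ = 2νf/(1 - 2ν), and
  -- absence of traction on AC forces C - A to be parallel to (f, -1).
  let C : Pt := !₂[-2 * ν, -(1 - 2 * ν) / f]
  have C0 : C 0 = -2 * ν := rfl
  have C1 : C 1 = -(1 - 2 * ν) / f := rfl
  have hC : C 1 < 0 := by
    rw [C1]
    exact div_neg_of_neg_of_pos (by linarith) hf
  have hk : C 0 / C 1 = 2 * ν * f / (1 - 2 * ν) := by
    rw [C0, C1]
    field_simp
  have n0 : sideNormal ptA C 0 = ‖C - ptA‖⁻¹ * (-(1 - 2 * ν) / f) := by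
    simp [sideNormal, C1, ptA]
  have n1 : sideNormal ptA C 1 = ‖C - ptA‖⁻¹ * (-(1 - 2 * ν)) := by
    simp [sideNormal, C0, ptA]
    ring_nf
    simp
  let lam := E * ν / ((1 + ν) * (1 - 2 * ν))
  have hlam : lam = E * ν / ((1 + ν) * (1 - 2 * ν)) := rfl
  let e : Matrix (Fin 2) (Fin 2) ℝ := !![-1, C 0 / C 1 / 2; C 0 / C 1 / 2, 0]
  have s00 : hooke E ν e 0 0 = -(lam * f * f) := by
    have : lam * f * f = E * (f * f * ν) / ((1 + ν) * (1 - 2 * ν)) := by rw [hlam]; ring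
    rw [this, hff']
    simp [hooke, e, Matrix.trace_fin_two]
    field_simp
    ring
  have s01 : hooke E ν e 0 1 = lam * f := by
    simp [hooke, e, hk, hlam]
    field_simp
  have s10 : hooke E ν e 1 0 = lam * f := by
    simp [hooke, e, hk, hlam]
    field_simp
  have s11 : hooke E ν e 1 1 = -lam := by
    simp [hooke, e, hlam, Matrix.trace_fin_two]
  refine ⟨C, hC, f, lam, hf, by positivity, fun v => ?_⟩
  rw [elastic_of_const_strain hC (slide_strain_ae hC) rfl ?_ v]
  · change hooke E ν e 0 1 * _ + hooke E ν e 1 1 * _ = _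
    rw [s01, s11]
    ring
  · intro i
    change hooke E ν e i 0 * _ + hooke E ν e i 1 * _ = _
    fin_cases i
    · simp only [Fin.zero_eta, s00, s01, n0, n1]
      field_simp
      ring
    · simp only [Fin.mk_one, s10, s11, n0, n1]
      field_simp
      ring

section Equilibria

variable {C : Pt} {hC : C 1 < 0} {E ν f lam : ℝ}

/-! ### The incremental problem -/

/-- The previous state is `slide` itself, so r ≤ 1 means that the increment slides in the negative
direction, as saturated friction requires; r ≥ 0 keeps the pressure compressive. -/
theorem isIncrementalSolution_smul_slide (hf : 0 < f) (hlam : 0 < lam)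
    (hel : ∀ v : V C, elastic E ν (slide hC) v = lam * (f * integralDual (len edgeC) v.tang -
      integralDual (len edgeC) v.nor)) {r : ℝ} (h0 : 0 ≤ r) (h1 : r ≤ 1) :
    IsIncrementalSolution E ν f 0 (constForce C 0) 0 (slide hC).tang (r • slide hC) := by
  refine ⟨-(lam * r) • integralDual (len edgeC), (lam * r * f) • integralDual (len edgeC),
    fun v => ?_, fun v => ?_, nonposDual_neg_smul_integralDual (by positivity), fun t _ => ?_⟩
  · rw [load_zero, elastic_smul_left, hel]
    simp only [smul_apply, smul_eq_mul]
    ring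
  · have hw : integralDual (len edgeC) (habs ((r • slide hC).tang - (slide hC).tang)) =
        -integralDual (len edgeC) ((r • slide hC).tang - (slide hC).tang) := by
      refine integralDual_habs_of_nonpos ?_
      rw [V.tang_smul]
      filter_upwards [hfn_sub_ae (r • (slide hC).tang) (slide hC).tang,
        hfn_smul_ae r (slide hC).tang, slide_tang_nonneg hC] with x a1 a2 a3
      rw [a1, a2]
      nlinarith
    have hv := integralDual_add_habs_nonneg (v.tang - (slide hC).tang)
    rw [load_zero, elastic_smul_left, hel, V.tang_sub, V.nor_sub]
    simp only [smul_apply, smul_eq_mul, hw]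
    simp only [map_sub] at hv ⊢
    have := mul_nonneg (mul_nonneg (mul_nonneg hlam.le h0) hf.le) hv
    linarith
  · rw [V.nor_smul, slide_nor, smul_zero, sub_zero, map_zero]

/-- Admissibility only asks the traction to lie in the friction cone, whatever the direction of
sliding, so no upper bound on r is needed. -/
theorem isAdmissible_smul_slide (hf : 0 < f) (hlam : 0 < lam)
    (hel : ∀ v : V C, elastic E ν (slide hC) v = lam * (f * integralDual (len edgeC) v.tang -
      integralDual (len edgeC) v.nor)) {r : ℝ} (h0 : 0 ≤ r) :
    IsAdmissible E ν f 0 (constForce C 0) 0 (r • slide hC) := by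
  refine ⟨-(lam * r) • integralDual (len edgeC), nonposDual_neg_smul_integralDual (by positivity),
    fun v => ?_, fun t _ => ?_⟩
  · have hv := integralDual_add_habs_nonneg v.tang
    rw [load_zero, elastic_smul_left, hel]
    simp only [smul_apply, smul_eq_mul]
    have := mul_nonneg (mul_nonneg (mul_nonneg hlam.le h0) hf.le) hv
    linarith
  · rw [V.nor_smul, slide_nor, smul_zero, sub_zero, map_zero]

end Equilibria

/-! ### Step functions in time -/

section Step

variable {S : ℝ} {H : Type*} [NormedAddCommGroup H] [NormedSpace ℝ H]

/-- The step function with value `2` before `s₀` and `1` from `s₀` on. -/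
def stepDown (s₀ s : Icc (0 : ℝ) S) : ℝ := if s < s₀ then 2 else 1

variable (s₀ : Icc (0 : ℝ) S)

theorem stepDown_of_lt {s : Icc (0 : ℝ) S} (h : s < s₀) : stepDown s₀ s = 2 := if_pos h

theorem stepDown_of_le {s : Icc (0 : ℝ) S} (h : s₀ ≤ s) : stepDown s₀ s = 1 :=
  if_neg (not_lt.2 h)

theorem stepDown_nonneg (s : Icc (0 : ℝ) S) : 0 ≤ stepDown s₀ s := by
  unfold stepDown
  split_ifs <;> norm_num

theorem isBVPlus_stepDown_smul (e : H) : IsBVPlus fun s => stepDown s₀ s • e := by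
  constructor
  · have hm : MonotoneOn (fun s => -stepDown s₀ s) univ := by
      intro s _ t _ hst
      simp only [stepDown]
      split_ifs with h1 h2 h2
      · norm_num
      · norm_num
      · exact absurd (hst.trans_lt h2) h1
      · norm_num
    have hb : BoundedVariationOn (fun s => -stepDown s₀ s) univ := by
      refine hm.boundedVariationOn (C := 2) fun s _ => ?_
      simp only [stepDown]
      split_ifs <;> norm_num
    let l : ℝ →L[ℝ] H := ContinuousLinearMap.toSpanSingleton ℝ (-e)
    have := l.lipschitz.comp_boundedVariationOn hb
    have he : (fun s => stepDown s₀ s • e) = l ∘ fun s => -stepDown s₀ s := by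
      funext s
      simp [l]
    rw [he]
    exact this
  · intro s
    rcases lt_or_ge s s₀ with h | h
    · have : (fun s => stepDown s₀ s • e) =ᶠ[𝓝 s] fun _ => (2 : ℝ) • e := by
        filter_upwards [Iio_mem_nhds h] with t ht
        rw [stepDown_of_lt s₀ ht]
      exact (this.continuousAt).continuousWithinAt
    · refine (continuousWithinAt_const (b := (1 : ℝ) • e)).congr (fun t ht => ?_) ?_
      · rw [stepDown_of_le s₀ (h.trans ht)]
      · rw [stepDown_of_le s₀ h]

theorem leftLim_stepDown_smul (h₀ : 0 < (s₀ : ℝ)) (e : H) :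
    Function.leftLim (fun s => stepDown s₀ s • e) s₀ = (2 : ℝ) • e := by
  have : (𝓝[<] s₀).NeBot := by
    have hb : (⟨0, le_rfl, s₀.2.1.trans s₀.2.2⟩ : Icc (0 : ℝ) S) < s₀ := h₀
    have hne : (Iio s₀).Nonempty := ⟨_, hb⟩
    rw [← mem_closure_iff_nhdsWithin_neBot, closure_Iio' hne]
    exact self_mem_Iic
  refine leftLim_eq_of_tendsto (tendsto_const_nhds.congr' ?_)
  filter_upwards [self_mem_nhdsWithin] with t ht
  rw [stepDown_of_lt s₀ ht]

theorem rightLim_stepDown_smul (s : Icc (0 : ℝ) S) (e : H) :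
    Function.rightLim (fun s => stepDown s₀ s • e) s = stepDown s₀ s • e :=
  ((isBVPlus_stepDown_smul s₀ e).2 s).rightLim_eq

/-- Both measures agree on the initial intervals, a π-system that generates the Borel sets. The atom
is -e because the factor drops from 2 to 1. -/
theorem vectorMeasure_stepDown_smul [CompleteSpace H] (h₀ : 0 < (s₀ : ℝ)) (e : H)
    (hu : BoundedVariationOn (fun s => stepDown s₀ s • e) univ) :
    hu.vectorMeasure = VectorMeasure.dirac s₀ (-e) := by
  have hS : 0 ≤ S := s₀.2.1.trans s₀.2.2
  let b : Icc (0 : ℝ) S := ⟨0, le_rfl, hS⟩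
  let t : Icc (0 : ℝ) S := ⟨S, hS, le_rfl⟩
  have hb : IsBot b := fun s => s.2.1
  have hIic : ∀ a, hu.vectorMeasure (Iic a) = VectorMeasure.dirac s₀ (-e) (Iic a) := by
    intro a
    have h1 : Iic a = Icc b a := by
      ext s
      exact ⟨fun h => ⟨hb s, h⟩, fun h => h.2⟩
    have h2 : stepDown s₀ b = 2 := stepDown_of_lt s₀ h₀
    -- The mass of [0, a] is the right limit at a minus the left limit at 0. The latter is by
    -- convention the value at 0, which is 2 e because s₀ > 0; so time 0 carries no atom.
    rw [h1, hu.vectorMeasure_Icc (hb a), leftLim_eq_of_isBot hb, rightLim_stepDown_smul, h2, ← h1]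
    rcases lt_or_ge a s₀ with h | h
    · rw [stepDown_of_lt s₀ h, sub_self, VectorMeasure.dirac_apply_of_notMem]
      exact fun h' => absurd h (not_lt.2 h')
    · rw [stepDown_of_le s₀ h, VectorMeasure.dirac_apply_of_mem measurableSet_Iic (mem_Iic.2 h)]
      module
  refine VectorMeasure.ext_of_generateFrom (range Iic) ?_ ?_ isPiSystem_Iic ?_
  · rintro _ ⟨a, rfl⟩
    exact hIic a
  · rw [← borel_eq_generateFrom_Iic]
    exact BorelSpace.measurable_eq
  · have : (univ : Set (Icc (0 : ℝ) S)) = Iic t := by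
      ext s
      exact ⟨fun _ => s.2.2, fun _ => trivial⟩
    rw [this]
    exact hIic t

/-- The weight is 1 plus the indicator of the times before s₀. -/
theorem integral_stepDown_mul {m : Measure (Icc (0 : ℝ) S)} {g : Icc (0 : ℝ) S → ℝ}
    (hg : Integrable g m) :
    Integrable (fun s => stepDown s₀ s * g s) m ∧
      ∫ s, stepDown s₀ s * g s ∂m = (∫ s, g s ∂m) + ∫ s in Iio s₀, g s ∂m := by
  have h : (fun s => stepDown s₀ s * g s) = fun s => g s + (Iio s₀).indicator g s := by
    funext s
    by_cases hs : s < s₀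
    · rw [stepDown_of_lt s₀ hs, indicator_of_mem (show s ∈ Iio s₀ from hs)]
      ring
    · rw [stepDown_of_le s₀ (not_lt.1 hs), indicator_of_notMem (show s ∉ Iio s₀ from hs)]
      ring
  have hi := hg.indicator (measurableSet_Iio (a := s₀))
  rw [h]
  exact ⟨hg.add hi, by rw [integral_add hg hi, integral_indicator measurableSet_Iio]⟩

/-- The right-hand side involves μ alone and is additive in μ. Densities with respect to different
total variations thereby become comparable in linear terms. -/
theorem IsPolar.integral_stepDown_mul {μ : VectorMeasure (Icc (0 : ℝ) S) H}
    {d : Icc (0 : ℝ) S → H} (hd : IsPolar μ d) [CompleteSpace H] (l : H →L[ℝ] ℝ) :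
    ∫ s, stepDown s₀ s * l (d s) ∂μ.variation = l (μ univ) + l (μ (Iio s₀)) := by
  rw [(Friction.integral_stepDown_mul s₀ (l.integrable_comp hd.1)).2, l.integral_comp_comm hd.1,
    l.integral_comp_comm hd.1.integrableOn, ← hd.2 _ measurableSet_Iio, hd.2 _ MeasurableSet.univ,
    setIntegral_univ]

/-- The total variation of the Dirac measure has an atom of mass ‖e‖ at s₀, so the density there is
forced to be the unit vector along e. -/
theorem IsPolar.dirac_apply [CompleteSpace H] {e : H} (he : e ≠ 0)
    {d : Icc (0 : ℝ) S → H} (hd : IsPolar (VectorMeasure.dirac s₀ e) d) :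
    d s₀ = ‖e‖⁻¹ • e := by
  have h := hd.2 {s₀} (measurableSet_singleton s₀)
  rw [VectorMeasure.dirac_apply_of_mem (measurableSet_singleton s₀) (mem_singleton s₀),
    VectorMeasure.variation_dirac, Measure.restrict_smul, integral_smul_measure,
    Measure.restrict_singleton, Measure.dirac_apply_of_mem (mem_singleton s₀), one_smul,
    integral_dirac, toReal_enorm] at h
  rw [h, smul_smul, ← h, inv_mul_cancel₀ (norm_ne_zero_iff.2 he), one_smul]

end Step

/-! ### Traces on `Γ_C` as bounded operators -/

section TraceOps

variable {C : Pt}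

/-- The `i`-th component of the trace, as a bounded operator from `V` to `L²(∂Ω)`. -/
def traceL (C : Pt) (i : Fin 2) : V C →L[ℝ] Lp ℝ 2 (len (bdry C)) where
  toFun v := hfn (v.trace i)
  map_add' _ _ := rfl
  map_smul' _ _ := rfl
  cont := by
    have h : Continuous fun v : V C => WithLp.ofLp v i :=
      (continuous_apply i).comp (PiLp.continuous_ofLp 2 _)
    exact continuous_hfn.comp (Triple.continuous_tr.comp (continuous_subtype_val.comp h))

theorem memLp_indicator_edgeC (C : Pt) :
    MemLp (edgeC.indicator fun _ => (1 : ℝ)) 2 (len (bdry C)) :=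
  (memLp_const 1).indicator measurableSet_edgeC

/-- The integral over `Γ_C`, as a bounded functional on `L²(∂Ω)`. -/
def integralEdgeC (C : Pt) : Lp ℝ 2 (len (bdry C)) →L[ℝ] ℝ :=
  innerSL ℝ ((memLp_indicator_edgeC C).toLp _)

theorem integralEdgeC_apply (q : Lp ℝ 2 (len (bdry C))) :
    integralEdgeC C q = ∫ x, q x ∂(len edgeC) := by
  have h : len edgeC = (len (bdry C)).restrict edgeC := by
    have hs : edgeC ⊆ bdry C := fun _ hx => Or.inl (Or.inl hx)
    rw [Measure.restrict_restrict_of_subset hs]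
  rw [h, ← integral_indicator measurableSet_edgeC, integralEdgeC, innerSL_apply_apply, L2.inner_def]
  refine integral_congr_ae ?_
  filter_upwards [(memLp_indicator_edgeC C).coeFn_toLp] with x hx
  rw [hx]
  by_cases hx' : x ∈ edgeC <;> simp [hx']

/-- The functional `v ↦ ∫_{Γ_C} v_i`. -/
def traceIntegral (C : Pt) (i : Fin 2) : V C →L[ℝ] ℝ := (integralEdgeC C).comp (traceL C i)

theorem traceIntegral_zero (v : V C) :
    traceIntegral C 0 v = integralDual (len edgeC) v.tang := by
  rw [integralDual_tang]
  exact integralEdgeC_apply _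

theorem traceIntegral_one (v : V C) :
    traceIntegral C 1 v = integralDual (len edgeC) v.nor := by
  rw [integralDual_nor]
  exact integralEdgeC_apply _

/-- Writes the friction term through the continuous lattice operation |·| of L², from which its
measurability and integrability in time follow. -/
theorem integralDual_habs_tang (v : V C) :
    integralDual (len edgeC) (habs v.tang) = integralEdgeC C |traceL C 0 v| := by
  rw [integralDual_habs, integralEdgeC_apply]
  refine integral_congr_ae ?_
  filter_upwards [hfn_hrestrict_ae (len_edgeC_le C) (v.trace 0),
    (Measure.absolutelyContinuous_of_le (len_edgeC_le C)).ae_le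
      (Lp.coeFn_abs (traceL C 0 v))] with x h1 h2
  rw [h2, V.tang, h1]
  rfl

theorem integrable_integralDual_habs_tang {X : Type*} [MeasurableSpace X] {m : Measure X}
    {d : X → V C} (hd : Integrable d m) :
    Integrable (fun s => integralDual (len edgeC) (habs (d s).tang)) m := by
  simp only [integralDual_habs_tang]
  refine (integralEdgeC C).integrable_comp ?_
  have h := (traceL C 0).integrable_comp hd
  have hc : Continuous fun q : Lp ℝ 2 (len (bdry C)) => |q| := continuous_id.sup continuous_neg
  refine h.mono (hc.comp_aestronglyMeasurable h.1) (ae_of_all _ fun s => ?_)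
  rw [norm_abs_eq_norm]

end TraceOps

/-! ### The quasi-static problem -/

section Quasistatic

variable {C : Pt} {hC : C 1 < 0} {E ν f lam : ℝ} {S : ℝ}

/-- The normal terms on the two sides cancel. The friction inequality then only involves tangential
terms, nonnegative for the test measure `v` and zero for the Dirac measure `u̇`. -/
theorem isQuasistaticSolution_stepDown_smul_slide (hf : 0 < f) (hlam : 0 < lam)
    (hel : ∀ v : V C, elastic E ν (slide hC) v = lam * (f * integralDual (len edgeC) v.tang -
      integralDual (len edgeC) v.nor)) (hS : 0 ≤ S) (s₀ : Icc (0 : ℝ) S) (h₀ : 0 < (s₀ : ℝ)) :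
    IsQuasistaticSolution E ν f hS 0 (fun _ => constForce C 0) 0 ((2 : ℝ) • slide hC)
      fun s => stepDown s₀ s • slide hC := by
  refine ⟨isBVPlus_stepDown_smul s₀ _, ?_, fun s => stepDown s₀ s • (-lam • integralDual _),
    isBVPlus_stepDown_smul s₀ _, fun s => ?_, ?_, fun s t _ => ?_⟩
  · have h : stepDown s₀ ⟨0, le_rfl, hS⟩ = 2 := stepDown_of_lt s₀ h₀
    exact congrArg (· • slide hC) h
  · simp only [smul_smul, mul_neg]
    exact nonposDual_neg_smul_integralDual (mul_nonneg (stepDown_nonneg s₀ s) hlam.le)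
  · intro hu v hv ρ ρv ρu hρ hρv hρu
    rw [vectorMeasure_stepDown_smul s₀ h₀] at hρ hρu ⊢
    have hne : -slide hC ≠ 0 := neg_ne_zero.2 (slide_ne_zero hC)
    set μ := VectorMeasure.dirac s₀ (-slide hC) with hμ
    set J := integralDual (len edgeC) with hJ
    have it := integral_stepDown_mul s₀ ((traceIntegral C 0).integrable_comp hρ.1)
    have itn := integral_stepDown_mul s₀ ((traceIntegral C 1).integrable_comp hρ.1)
    have e1 : ∫ s, elastic E ν (stepDown s₀ s • slide hC) (ρ s) ∂(v - μ).variation =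
        lam * f * (∫ s, stepDown s₀ s * traceIntegral C 0 (ρ s) ∂(v - μ).variation) -
          lam * ∫ s, stepDown s₀ s * traceIntegral C 1 (ρ s) ∂(v - μ).variation := by
      rw [← integral_const_mul, ← integral_const_mul,
        ← integral_sub (it.1.const_mul _) (itn.1.const_mul _)]
      congr 1
      funext s
      rw [elastic_smul_left, hel, traceIntegral_zero, traceIntegral_one]
      ring
    have e2 : ∫ s, (stepDown s₀ s • (-lam • J)) (ρ s).nor ∂(v - μ).variation =
        -lam * ∫ s, stepDown s₀ s * traceIntegral C 1 (ρ s) ∂(v - μ).variation := by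
      rw [← integral_const_mul]
      congr 1
      funext s
      simp only [smul_apply, smul_eq_mul, traceIntegral_one]
      ring
    have e3 : ∀ (m : Measure (Icc (0 : ℝ) S)) (d : Icc (0 : ℝ) S → V C),
        ∫ s, f * (stepDown s₀ s • (-lam • J)) (habs (d s).tang) ∂m =
          -(lam * f) * ∫ s, stepDown s₀ s * J (habs (d s).tang) ∂m := by
      intro m d
      rw [← integral_const_mul]
      congr 1
      funext s
      simp only [smul_apply, smul_eq_mul]
      ring
    have e4 : ∫ s, load ((0 : Icc (0 : ℝ) S → Lp Pt 2 (area C)) s) (constForce C 0) (ρ s)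
        ∂(v - μ).variation = 0 := by
      simp only [Pi.zero_apply, load_zero, integral_zero]
    -- Additivity of the linear tangential term, although the three densities refer to three
    -- different total variation measures.
    have k1 : ∫ s, stepDown s₀ s * traceIntegral C 0 (ρ s) ∂(v - μ).variation =
        (∫ s, stepDown s₀ s * traceIntegral C 0 (ρv s) ∂v.variation) -
          ∫ s, stepDown s₀ s * traceIntegral C 0 (ρu s) ∂μ.variation := by
      rw [hρ.integral_stepDown_mul, hρv.integral_stepDown_mul, hρu.integral_stepDown_mul]
      simp only [sub_apply, map_sub]
      ring
    have k2 : 0 ≤ (∫ s, stepDown s₀ s * traceIntegral C 0 (ρv s) ∂v.variation) +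
        ∫ s, stepDown s₀ s * J (habs (ρv s).tang) ∂v.variation := by
      rw [← integral_add (integral_stepDown_mul s₀ ((traceIntegral C 0).integrable_comp hρv.1)).1
        (integral_stepDown_mul s₀ (integrable_integralDual_habs_tang hρv.1)).1]
      refine integral_nonneg fun s => ?_
      simp only [← mul_add, traceIntegral_zero]
      exact mul_nonneg (stepDown_nonneg s₀ s) (integralDual_add_habs_nonneg _)
    -- All of `u̇` sits at s₀, with density a negative multiple of `slide`: the jump slides in the
    -- negative direction, so the friction inequality is an equality for it.
    have k3 : ∫ s, stepDown s₀ s * J (habs (ρu s).tang) ∂μ.variation =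
        -∫ s, stepDown s₀ s * traceIntegral C 0 (ρu s) ∂μ.variation := by
      have hd : J (habs (ρu s₀).tang) = -J (ρu s₀).tang := by
        refine integralDual_habs_of_nonpos ?_
        rw [hρu.dirac_apply s₀ hne, smul_neg, ← neg_smul, V.tang_smul]
        filter_upwards [hfn_smul_ae (-‖-slide hC‖⁻¹) (slide hC).tang,
          slide_tang_nonneg hC] with x h1 h2
        rw [h1, neg_mul]
        exact neg_nonpos.2 (mul_nonneg (by positivity) h2)
      rw [hμ, VectorMeasure.variation_dirac, integral_smul_measure, integral_smul_measure,
        integral_dirac, integral_dirac, hd, traceIntegral_zero, mul_neg, smul_neg]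
    rw [e1, e2, e3, e3, e4, k1, k3]
    have := mul_nonneg (mul_nonneg hlam.le hf.le) k2
    linarith
  · rw [V.nor_smul, slide_nor, smul_zero, sub_zero, map_zero]

end Quasistatic

end Friction

end

theorem mainTheorem7 (E ν : ℝ) (hE : 0 < E) (hν : 0 < ν) (hν' : ν < 1 / 2) :
    ∃ C : Friction.Pt, C 1 < 0 ∧ ∃ f : ℝ, 0 < f ∧
      (∃ (T : Friction.Pt) (w : Friction.Hhalf (Friction.len Friction.edgeC))
          (γ : unitInterval → Friction.V C), Continuous γ ∧ Function.Injective γ ∧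
        ∀ r, (∃ a, Friction.IsLinearInterp (γ r) a) ∧
          Friction.IsIncrementalSolution E ν f 0 (Friction.constForce C T) 0 w (γ r)) ∧
      ∀ (S : ℝ) (hS : 0 < S),
        ∃ (T : Set.Icc (0 : ℝ) S → Friction.Pt) (K : NNReal) (u₀ : Friction.V C)
            (u : Set.Icc (0 : ℝ) S → Friction.V C), LipschitzWith K T ∧
          Friction.IsAdmissible E ν f 0 (Friction.constForce C (T ⟨0, le_rfl, hS.le⟩)) 0 u₀ ∧
          Friction.IsQuasistaticSolution E ν f hS.le 0 (fun s => Friction.constForce C (T s)) 0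
            u₀ u ∧
          (∀ s, ∃ a, Friction.IsLinearInterp (u s) a) ∧
          ∃ s, Function.leftLim u s ≠ Function.rightLim u s := by
  obtain ⟨C, hC, f, lam, hf, hlam, hel⟩ := Friction.exists_critical_triangle hE hν hν'
  have hne := Friction.slide_ne_zero hC
  refine ⟨C, hC, f, hf, ⟨0, (Friction.slide hC).tang, fun r => (r : ℝ) • Friction.slide hC,
    by fun_prop, fun r s hrs => Subtype.ext (smul_left_injective ℝ hne hrs), fun r =>
    ⟨⟨_, Friction.isLinearInterp_smul_slide hC r⟩,
      Friction.isIncrementalSolution_smul_slide hf hlam hel r.2.1 r.2.2⟩⟩, fun S hS => ?_⟩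
  -- Any positive jump time would do, since the load stays zero and nothing triggers the jump.
  let s₀ : Set.Icc (0 : ℝ) S := ⟨S / 2, by positivity, by linarith⟩
  have h₀ : 0 < (s₀ : ℝ) := half_pos hS
  refine ⟨fun _ => 0, 0, (2 : ℝ) • Friction.slide hC,
    fun s => Friction.stepDown s₀ s • Friction.slide hC, LipschitzWith.const 0,
    Friction.isAdmissible_smul_slide hf hlam hel zero_le_two,
    Friction.isQuasistaticSolution_stepDown_smul_slide hf hlam hel hS.le s₀ h₀,
    fun s => ⟨_, Friction.isLinearInterp_smul_slide hC _⟩, s₀, ?_⟩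
  rw [Friction.leftLim_stepDown_smul s₀ h₀, Friction.rightLim_stepDown_smul,
    Friction.stepDown_of_le s₀ le_rfl]
  exact fun h => by simpa using smul_left_injective ℝ hne h
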